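/- **Setting.** There are $U\ge 1$ users; user $u$ has an unknown preference vector $\theta_u\in\mathbb R^d$ with $\|\theta_u\|_2\le 1$, and there is $\gamma>0$ with $\|\theta_u-\theta_v\|_2\ge\gamma$ whenever $\theta_u\ne\theta_v$. User $u$ has $N_u$ samples $(a_u^i,r_u^i)_{i\le N_u}$. *Actions:* $\rho$ is a distribution on the unit ball of $\mathbb R^d$ such that $\mathbb E_{a\sim\rho}[aa^\top]$ has smallest eigenvalue $\lambda_a>0$, and for every unit vector $x$ the variable $(x^\top a)^2$, $a\sim\rho$, has sub-Gaussian tails with variance proxy $\sigma^2>0$: for all $t\ge 0$, each of the probabilities that $(x^\top a)^2-\mathbb E(x^\top a)^2$ is $\ge t$, or is $\le -t$, is at most $e^{-t^2/(2\sigma^2)}$. Each action $a_u^i$ is selected, by an arbitrary rule, from a finite candidate set of at most $S$ vectors; for each user the candidates of all rounds are independent draws from $\rho$. Put $\tilde\lambda_a=\int_0^{\lambda_a}\bigl(1-e^{-(\lambda_a-x)^2/(2\sigma^2)}\bigr)^S\,dx$. *Rewards:* conditionally on $a_u^1,\dots,a_u^i$ and $r_u^1,\dots,r_u^{i-1}$,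 the reward $r_u^i$ is 1-sub-Gaussian with mean $\langle\theta_u,a_u^i\rangle$. **Algorithm.** For inputs $\alpha,\lambda,\delta,\hat\gamma$ let $M_u=\lambda I+\sum_i a_u^i(a_u^i)^\top$, $\hat\theta_u=M_u^{-1}\sum_i r_u^ia_u^i$, $$\mathrm{CI}_u=\frac{\sqrt{d\log(1+\frac{N_u}{\lambda d})+2\log\frac{2U}{\delta}}+\sqrt\lambda}{\sqrt{\tilde\lambda_aN_u/2}},\qquad N_{\min}=\frac{16}{\tilde\lambda_a^2}\log\frac{8Ud}{\tilde\lambda_a^2\delta}.$$ Two distinct users $u,v$ are connected iff $\|\hat\theta_u-\hat\theta_v\|_2<\hat\gamma-\alpha(\mathrm{CI}_u+\mathrm{CI}_v)$ and $\min\{N_u,N_v\}\ge N_{\min}$. Let $\mathcal V_{\hat\gamma}(u)$ consist of $u$ and the users connected to $u$, $\mathcal R_{\hat\gamma}(u)=\{v\in\mathcal V_{\hat\gamma}(u):\theta_v=\theta_u\}$ and $\mathcal W_{\hat\gamma}(u)=\{v\in\mathcal V_{\hat\gamma}(u):\theta_v\ne\theta_u\}$. **Lemma.** Let $\alpha\ge1$,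 $\lambda>0$, $\delta\in(0,1)$, $\hat\gamma\ge0$ with $$\lambda\le d\log\Bigl(1+\frac{\min_uN_u}{\lambda d}\Bigr)+2\log\frac{2U}{\delta},\qquad \delta\le\frac{2U}{1+\max_uN_u/(\lambda d)}.$$ Then there exist random variables $\alpha_r(u,v)$ and $\alpha_w(u,v)$, one of each for every pair of users, which always satisfy $$\alpha_r(u,v)\in\Bigl[\tfrac{\sqrt{\tilde\lambda_a}}{4(\alpha+1)\sqrt{\log(2U/\delta)\max\{2,d\}}},\ \tfrac{\sqrt{\tilde\lambda_a}}{2\alpha\sqrt{\log(2U/\delta)}}\Bigr),\qquad \alpha_w(u,v)\in\Bigl(0,\ \tfrac{\sqrt{\tilde\lambda_a}}{2(\alpha-1)\sqrt{\log(2U/\delta)}}\Bigr]$$ (for $\alpha=1$ the second range is $(0,\infty)$), such that with probability at least $1-\delta$ the following holds simultaneously for all users $u$. If $N_u\ge N_{\min}$, then $$\mathcal R_{\hat\gamma}(u)=\{u\}\cup\Bigl\{v:\theta_u=\theta_v,\ \tfrac1{\sqrt{N_u}}+\tfrac1{\sqrt{N_v}}\le\alpha_r(u,v)\,\hat\gamma,\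 N_v\ge N_{\min}\Bigr\},$$ $$\mathcal W_{\hat\gamma}(u)=\Bigl\{v:\gamma\le\|\theta_u-\theta_v\|_2\le\hat\gamma,\ \tfrac1{\sqrt{N_u}}+\tfrac1{\sqrt{N_v}}\le\alpha_w(u,v)(\hat\gamma-\gamma),\ N_v\ge N_{\min}\Bigr\}.$$ If $N_u<N_{\min}$, then $\mathcal R_{\hat\gamma}(u)=\{u\}$ and $\mathcal W_{\hat\gamma}(u)=\emptyset$. -/

import Mathlib

open MeasureTheory ProbabilityTheory Set
open scoped RealInnerProductSpace

noncomputable section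

namespace OffClusBand

/-- Actions and preference vectors live in `ℝ^d` with the Euclidean norm. -/
abbrev Vec (d : ℕ) := EuclideanSpace ℝ (Fin d)

/-- A random offline dataset for `U` users: user `u` has `N u` samples
`(action u i, reward u i)`, `i = 0, …, N u - 1`. -/
structure Dataset (Ω : Type*) [MeasurableSpace Ω] (U d : ℕ) where
  N : Fin U → ℕ
  action : (u : Fin U) → Fin (N u) → Ω → Vec d
  reward : (u : Fin U) → Fin (N u) → Ω → ℝ
  measurable_action : ∀ u i, Measurable (action u i)
  measurable_reward : ∀ u i, Measurable (reward u i)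

/-! ### The action distribution -/

/-- The matrix `E_{a ∼ ρ}[a aᵀ]`. -/
def secondMoment {d : ℕ} (ρ : Measure (Vec d)) : Matrix (Fin d) (Fin d) ℝ :=
  Matrix.of fun i j => ∫ a, a i * a j ∂ρ

/-- `ρ` is a distribution on the unit ball whose matrix `E[a aᵀ]` has smallest eigenvalue
`lamA > 0`, and for every unit vector `x` the variable `⟨x, a⟩²` has sub-Gaussian tails around its
mean with variance proxy `σ²`. -/
structure RegularLaw {d : ℕ} (ρ : Measure (Vec d)) (lamA σ : ℝ) : Prop where
  isProbability : IsProbabilityMeasure ρ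
  norm_le_one : ∀ᵐ a ∂ρ, ‖a‖ ≤ 1
  isLeast_eigenvalue : IsLeast (spectrum ℝ (secondMoment ρ)) lamA
  lamA_pos : 0 < lamA
  sigma_pos : 0 < σ
  upper_tail : ∀ x : Vec d, ‖x‖ = 1 → ∀ t : ℝ, 0 ≤ t →
    ρ.real {a | (∫ b, ⟪x, b⟫ ^ 2 ∂ρ) + t ≤ ⟪x, a⟫ ^ 2} ≤ Real.exp (-t ^ 2 / (2 * σ ^ 2))
  lower_tail : ∀ x : Vec d, ‖x‖ = 1 → ∀ t : ℝ, 0 ≤ t →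
    ρ.real {a | ⟪x, a⟫ ^ 2 ≤ (∫ b, ⟪x, b⟫ ^ 2 ∂ρ) - t} ≤ Real.exp (-t ^ 2 / (2 * σ ^ 2))

/-- The smoothed regularity parameter. -/
def smoothedRegularity (lamA σ : ℝ) (S : ℕ) : ℝ :=
  ∫ x in (0 : ℝ)..lamA, (1 - Real.exp (-(lamA - x) ^ 2 / (2 * σ ^ 2))) ^ S

/-- Every action of every user is selected, by an arbitrary rule, from a finite candidate set of
at most `S` vectors; for each user the candidates (over all rounds) are independent draws
from `ρ`. -/
def SelectedFromCandidates {Ω : Type*} [MeasurableSpace Ω] (μ : Measure Ω) {U d : ℕ}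
    (D : Dataset Ω U d) (ρ : Measure (Vec d)) (S : ℕ) : Prop :=
  ∀ u, ∃ (K : Fin (D.N u) → ℕ) (c : (i : Fin (D.N u)) → Fin (K i) → Ω → Vec d),
    (∀ i, K i ≤ S) ∧
    (∀ i k, Measurable (c i k)) ∧
    iIndepFun (fun p : (Σ i : Fin (D.N u), Fin (K i)) => c p.1 p.2) μ ∧
    (∀ i k, μ.map (c i k) = ρ) ∧
    ∀ i, ∀ᵐ ω ∂μ, ∃ k, D.action u i ω = c i k ω

/-! ### The rewards -/

/-- The σ-algebra generated by the actions of user `u` up to and including round `i` and the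
rewards of user `u` strictly before round `i`. -/
@[reducible] def Dataset.history {Ω : Type*} [MeasurableSpace Ω] {U d : ℕ} (D : Dataset Ω U d)
    (u : Fin U) (i : Fin (D.N u)) : MeasurableSpace Ω :=
  (⨆ j : Fin (D.N u), ⨆ _ : j ≤ i, MeasurableSpace.comap (D.action u j) inferInstance) ⊔
  (⨆ j : Fin (D.N u), ⨆ _ : j < i, MeasurableSpace.comap (D.reward u j) inferInstance)

/-- Given the past and the current action `a`, the reward of user `u` is 1-sub-Gaussian around
`⟨θ_u, a⟩` (in particular its conditional mean is `⟨θ_u, a⟩`). -/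
def SubGaussianRewards {Ω : Type*} [MeasurableSpace Ω] (μ : Measure Ω) {U d : ℕ}
    (D : Dataset Ω U d) (θ : Fin U → Vec d) : Prop :=
  ∀ (u : Fin U) (i : Fin (D.N u)) (t : ℝ),
    Integrable (fun ω => Real.exp (t * (D.reward u i ω - ⟪θ u, D.action u i ω⟫))) μ ∧
    ∀ᵐ ω ∂μ,
      (μ[fun ω' => Real.exp (t * (D.reward u i ω' - ⟪θ u, D.action u i ω'⟫)) | D.history u i]) ω
        ≤ Real.exp (t ^ 2 / 2)

/-! ### The statistics and the graph computed by the algorithm Off-C²LUB -/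

variable {Ω : Type*} [MeasurableSpace Ω] {U d : ℕ}

/-- `M_u = λ I + ∑ᵢ aᵢ aᵢᵀ`. -/
def Dataset.gram (D : Dataset Ω U d) (lam : ℝ) (u : Fin U) (ω : Ω) :
    Matrix (Fin d) (Fin d) ℝ :=
  lam • (1 : Matrix (Fin d) (Fin d) ℝ) +
    ∑ i, Matrix.vecMulVec (D.action u i ω).ofLp (D.action u i ω).ofLp

/-- `b_u = ∑ᵢ rᵢ aᵢ`. -/
def Dataset.moment (D : Dataset Ω U d) (u : Fin U) (ω : Ω) : Vec d :=
  ∑ i, D.reward u i ω • D.action u i ω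

/-- The ridge estimate `M_u⁻¹ b_u`. -/
def Dataset.ridge (D : Dataset Ω U d) (lam : ℝ) (u : Fin U) (ω : Ω) : Vec d :=
  WithLp.toLp 2 (Matrix.mulVec (D.gram lam u ω)⁻¹ (D.moment u ω).ofLp)

/-- The confidence radius `CI_u` (`lamT` is the smoothed regularity parameter). -/
def Dataset.CI (D : Dataset Ω U d) (lamT lam δ : ℝ) (u : Fin U) : ℝ :=
  (Real.sqrt (d * Real.log (1 + D.N u / (lam * d)) + 2 * Real.log (2 * U / δ)) + Real.sqrt lam) /
    Real.sqrt (lamT * D.N u / 2)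

/-- `N_min = (16 / λ̃²) log (8 U d / (λ̃² δ))`. -/
def Nmin (U d : ℕ) (lamT δ : ℝ) : ℝ :=
  16 / lamT ^ 2 * Real.log (8 * U * d / (lamT ^ 2 * δ))

/-- The random graph produced by the cluster phase. -/
def Dataset.graph (D : Dataset Ω U d) (lamT α lam δ γhat : ℝ) (ω : Ω) : SimpleGraph (Fin U) where
  Adj u v := u ≠ v ∧
    ‖D.ridge lam u ω - D.ridge lam v ω‖ < γhat - α * (D.CI lamT lam δ u + D.CI lamT lam δ v) ∧
    Nmin U d lamT δ ≤ min (D.N u : ℝ) (D.N v : ℝ)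
  symm := ⟨by
    intro u v h
    refine ⟨h.1.symm, ?_, ?_⟩
    · rw [norm_sub_rev, add_comm (D.CI lamT lam δ v)]; exact h.2.1
    · rw [min_comm]; exact h.2.2⟩
  loopless := ⟨fun _ h => h.1 rfl⟩

/-- `u` together with its neighbours in the graph. -/
def Dataset.nbhd (D : Dataset Ω U d) (lamT α lam δ γhat : ℝ) (u : Fin U) (ω : Ω) :
    Set (Fin U) :=
  {u} ∪ {v | (D.graph lamT α lam δ γhat ω).Adj u v}

/-- `R(u)`: the users in `V(u)` with the same preference vector as `u`. -/
def Dataset.R (D : Dataset Ω U d) (θ : Fin U → Vec d) (lamT α lam δ γhat : ℝ) (u : Fin U)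
    (ω : Ω) : Set (Fin U) :=
  {v | v ∈ D.nbhd lamT α lam δ γhat u ω ∧ θ u = θ v}

/-- `W(u)`: the users in `V(u)` with a preference vector different from that of `u`. -/
def Dataset.W (D : Dataset Ω U d) (θ : Fin U → Vec d) (lamT α lam δ γhat : ℝ) (u : Fin U)
    (ω : Ω) : Set (Fin U) :=
  {v | v ∈ D.nbhd lamT α lam δ γhat u ω ∧ θ u ≠ θ v}

end OffClusBand

end

noncomputable section

namespace OffClusBand

/-! ### Regularized Gram matrices -/

/-! The factors may depend on the outcome, so they are read off the graph: each takes one value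
where `u` and `v` are adjacent and another where they are not. It remains to see that the prescribed
ranges contain suitable values. Write `s = 1/√N_u + 1/√N_v`. Adjacency forces `α (CI_u + CI_v) <
γhat`, and `Dataset.lt_CI` turns this into `s < hi * γhat`, with `hi` the upper end of the range of
`αr`; a factor below `hi` then still covers `s`. If two users with equal preferences and enough
samples are not adjacent while both estimates lie within their radii, then `γhat < (α + 1) (CI_u +
CI_v)`, and `Dataset.CI_le` shows that the lower end of the range fails to cover `s`. For different
preferences, adjacency gives `γ ≤ ‖θ_u - θ_v‖ < γhat - (α - 1) (CI_u + CI_v)`, and non-adjacency is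
matched by a small factor, as the range of `αw` reaches down to 0. The probabilistic input is
`measure_CI_le_le`: a user with `N_u ≥ N_min` leaves its radius with probability at most `δ / U`.
Half of this pays for the noise in the norm of `M⁻¹` (`measure_selfNormalized_gt_le`): an
exponential supermartingale is averaged over a Gaussian family of directions, and Markov's
inequality applies. The other half pays for `∑ aᵢaᵢᵀ ≥ (lamT N_u / 2) I`
(`measure_not_quadratic_ge_le`): as the selection rule is arbitrary, each action is replaced by the
worst candidate of its round. These minima are independent with mean at least `lamT`, so a Chernoff
bound and a net of the sphere finish. -/

/-- The matrix `lam • 1 + ∑ᵢ aᵢ aᵢᵀ`. -/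
def ridgeGram {d N : ℕ} (lam : ℝ) (a : Fin N → Vec d) : Matrix (Fin d) (Fin d) ℝ :=
  lam • (1 : Matrix (Fin d) (Fin d) ℝ) + ∑ i, Matrix.vecMulVec (a i).ofLp (a i).ofLp

section Gram

variable {d N : ℕ} {lam : ℝ} (a : Fin N → Vec d)

lemma toEuclideanLin_ridgeGram (x : Vec d) :
    Matrix.toEuclideanLin (ridgeGram lam a) x = lam • x + ∑ i, ⟪a i, x⟫ • a i := by
  ext j
  simp only [ridgeGram, Matrix.ofLp_toLpLin, Matrix.toLin'_apply, Matrix.add_mulVec, Matrix.smul_mulVec,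
    Matrix.one_mulVec, Matrix.sum_mulVec, PiLp.add_apply, PiLp.smul_apply, Pi.add_apply,
    Pi.smul_apply, Finset.sum_apply, WithLp.ofLp_sum, WithLp.ofLp_smul, Matrix.vecMulVec_mulVec]
  congr 1
  refine Finset.sum_congr rfl fun i _ => ?_
  simp [PiLp.inner_apply, dotProduct, mul_comm]

lemma inner_toEuclideanLin_ridgeGram (x y : Vec d) :
    ⟪x, Matrix.toEuclideanLin (ridgeGram lam a) y⟫ =
      lam * ⟪x, y⟫ + ∑ i, ⟪a i, x⟫ * ⟪a i, y⟫ := by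
  rw [toEuclideanLin_ridgeGram, inner_add_right, inner_smul_right, inner_sum]
  congr 1
  refine Finset.sum_congr rfl fun i _ => ?_
  rw [inner_smul_right, real_inner_comm, mul_comm, real_inner_comm x]

lemma ridgeGram_posDef (hlam : 0 < lam) : (ridgeGram lam a).PosDef := by
  refine Matrix.PosDef.add_posSemidef (Matrix.PosDef.one.smul hlam) ?_
  refine Matrix.posSemidef_sum _ fun i _ => ?_
  simpa using Matrix.posSemidef_vecMulVec_self_star (a i).ofLp

open scoped MatrixOrder in
/-- The symmetric square root of the regularized Gram matrix, as a linear map. -/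
lemma exists_sqrt_ridgeGram (hlam : 0 < lam) :
    ∃ T : Vec d →ₗ[ℝ] Vec d, 0 < LinearMap.det T ∧
      LinearMap.det T ^ 2 = (ridgeGram lam a).det ∧
      ∀ x y, ⟪T x, T y⟫ = lam * ⟪x, y⟫ + ∑ i, ⟪a i, x⟫ * ⟪a i, y⟫ := by
  have hM := ridgeGram_posDef a hlam
  have hM0 : 0 ≤ ridgeGram lam a := Matrix.nonneg_iff_posSemidef.2 hM.posSemidef
  set B := CFC.sqrt (ridgeGram lam a) with hB
  have hBB : B * B = ridgeGram lam a := CFC.sqrt_mul_sqrt_self _ hM0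
  have hBp : B.PosSemidef := Matrix.nonneg_iff_posSemidef.1 (CFC.sqrt_nonneg _)
  have hdet : LinearMap.det (Matrix.toEuclideanLin B) = B.det := by
    rw [Matrix.toEuclideanLin, Matrix.toLpLin_eq_toLin, LinearMap.det_toLin]
  have hd2 : B.det ^ 2 = (ridgeGram lam a).det := by rw [← hBB, Matrix.det_mul, sq]
  refine ⟨Matrix.toEuclideanLin B, ?_, by rw [hdet, hd2], fun x y => ?_⟩
  · rw [hdet]
    refine lt_of_le_of_ne hBp.det_nonneg fun h => ?_
    have := hM.det_pos
    rw [← hd2, ← h] at this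
    simp at this
  · rw [← inner_toEuclideanLin_ridgeGram]
    have hsym := Matrix.isSymmetric_toEuclideanLin_iff.2 hBp.isHermitian
    rw [hsym x _, ← hBB]
    congr 1
    ext j
    simp [Matrix.mulVec_mulVec]

lemma trace_ridgeGram_le (ha : ∀ i, ‖a i‖ ≤ 1) : (ridgeGram lam a).trace ≤ lam * d + N := by
  rw [ridgeGram, Matrix.trace_add, Matrix.trace_smul, Matrix.trace_one, Matrix.trace_sum,
    Fintype.card_fin, smul_eq_mul]
  gcongr
  calc ∑ i, (Matrix.vecMulVec (a i).ofLp (a i).ofLp).trace ≤ ∑ _i : Fin N, (1 : ℝ) := by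
        refine Finset.sum_le_sum fun i _ => ?_
        have h := real_inner_self_eq_norm_sq (a i)
        rw [PiLp.inner_apply] at h
        rw [Matrix.trace_vecMulVec, dotProduct]
        have h2 : ‖a i‖ ^ 2 ≤ 1 := pow_le_one₀ (norm_nonneg _) (ha i)
        simpa [← sq] using h.trans_le h2
    _ = N := by simp

/-- The determinant-trace inequality. -/
lemma det_ridgeGram_le (hd : 0 < d) (hlam : 0 < lam) (ha : ∀ i, ‖a i‖ ≤ 1) :
    (ridgeGram lam a).det ≤ (lam + N / d) ^ d := by
  have hd' : (0 : ℝ) < d := by exact_mod_cast hd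
  have hM := ridgeGram_posDef a hlam
  set e := hM.isHermitian.eigenvalues with he
  have hc : 0 < lam + N / d := by positivity
  have htr : ∑ i, e i ≤ d * (lam + N / d) := by
    have h1 := hM.isHermitian.trace_eq_sum_eigenvalues
    have h2 := trace_ridgeGram_le (lam := lam) a ha
    have h3 : (d : ℝ) * (lam + N / d) = lam * d + N := by field_simp
    rw [h3]
    simpa [he] using h1.symm.trans_le h2
  rw [hM.isHermitian.det_eq_prod_eigenvalues]
  -- AM-GM in exponential form: with `c = lam + N / d`, each eigenvalue satisfies `e ≤ c exp (e / c
  -- - 1)`, and the exponents sum to `tr / c - d ≤ 0`.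
  calc ∏ i, ((e i : ℝ)) ≤ ∏ i : Fin d, ((lam + N / d) * Real.exp (e i / (lam + N / d) - 1)) := by
        refine Finset.prod_le_prod (fun i _ => (hM.eigenvalues_pos i).le) fun i _ => ?_
        have := Real.add_one_le_exp (e i / (lam + N / d) - 1)
        calc e i = (lam + N / d) * (e i / (lam + N / d) - 1 + 1) := by field_simp; ring
          _ ≤ _ := by gcongr
    _ = (lam + N / d) ^ d * Real.exp ((∑ i, e i) / (lam + N / d) - d) := by
        rw [Finset.prod_mul_distrib, ← Real.exp_sum, Finset.sum_sub_distrib, Finset.sum_div]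
        simp
    _ ≤ (lam + N / d) ^ d * 1 := by
        gcongr
        rw [Real.exp_le_one_iff, sub_nonpos, div_le_iff₀ hc]
        exact htr
    _ = _ := mul_one _

lemma toEuclideanLin_ridgeGram_inv_mulVec (hlam : 0 < lam) (v : Vec d) :
    Matrix.toEuclideanLin (ridgeGram lam a)
      (WithLp.toLp 2 (Matrix.mulVec (ridgeGram lam a)⁻¹ v.ofLp)) = v := by
  have hu : IsUnit (ridgeGram lam a).det := (ridgeGram_posDef a hlam).det_pos.ne'.isUnit
  ext j
  simp [Matrix.mulVec_mulVec, Matrix.mul_nonsing_inv _ hu]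

/-- If `M y = S - lam • θ` and `M w = S`, then `‖y‖_M ≤ ‖w‖_M + √lam`. -/
lemma norm_sub_lt_of_ridgeGram (hlam : 0 < lam) {θ θh S w : Vec d} (hθ : ‖θ‖ ≤ 1)
    (hθh : Matrix.toEuclideanLin (ridgeGram lam a) θh =
      S + Matrix.toEuclideanLin (ridgeGram lam a) θ - lam • θ)
    (hw : Matrix.toEuclideanLin (ridgeGram lam a) w = S)
    {β κ : ℝ} (hβ : 0 ≤ β) (hwS : ⟪w, S⟫ ≤ β ^ 2) (hκ : 0 < κ)
    (hV : ∀ x : Vec d, κ * ‖x‖ ^ 2 ≤ ∑ i, ⟪a i, x⟫ ^ 2) :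
    ‖θh - θ‖ < (β + Real.sqrt lam) / Real.sqrt κ := by
  obtain ⟨T, -, -, hT⟩ := exists_sqrt_ridgeGram a hlam
  have hTn : ∀ x, ‖T x‖ ^ 2 = lam * ‖x‖ ^ 2 + ∑ i, ⟪a i, x⟫ ^ 2 := fun x => by
    rw [← real_inner_self_eq_norm_sq, hT, real_inner_self_eq_norm_sq]
    simp [sq]
  set y := θh - θ with hy
  have hMy : Matrix.toEuclideanLin (ridgeGram lam a) y = S - lam • θ := by
    rw [hy, map_sub, hθh]; abel
  have hTw : ‖T w‖ ≤ β := by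
    refine abs_le_of_sq_le_sq' ?_ hβ |>.2
    rw [← real_inner_self_eq_norm_sq, hT, ← inner_toEuclideanLin_ridgeGram, hw]
    exact hwS
  have hlow : (lam + κ) * ‖y‖ ^ 2 ≤ ‖T y‖ ^ 2 := by
    rw [hTn, add_mul]; gcongr; exact hV y
  have hsl : Real.sqrt lam * ‖y‖ ≤ ‖T y‖ := by
    refine abs_le_of_sq_le_sq' ?_ (norm_nonneg _) |>.2
    rw [mul_pow, Real.sq_sqrt hlam.le]
    nlinarith [sq_nonneg ‖y‖]
  have hmain : ‖T y‖ ^ 2 ≤ ‖T y‖ * (β + Real.sqrt lam) := by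
    have h1 : ‖T y‖ ^ 2 = ⟪y, S⟫ - lam * ⟪y, θ⟫ := by
      rw [← real_inner_self_eq_norm_sq, hT, ← inner_toEuclideanLin_ridgeGram, hMy,
        inner_sub_right, inner_smul_right]
    have h2 : ⟪y, S⟫ = ⟪T y, T w⟫ := by
      rw [hT, ← inner_toEuclideanLin_ridgeGram, hw]
    have h3 : ⟪T y, T w⟫ ≤ ‖T y‖ * β :=
      (real_inner_le_norm _ _).trans (by gcongr)
    have h4 : -⟪y, θ⟫ ≤ ‖y‖ := by
      have h5 := (abs_le.1 (abs_real_inner_le_norm y θ)).1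
      nlinarith [norm_nonneg y]
    have h6 : lam * -⟪y, θ⟫ ≤ ‖T y‖ * Real.sqrt lam := by
      calc lam * -⟪y, θ⟫ ≤ lam * ‖y‖ := by gcongr
        _ = (Real.sqrt lam * ‖y‖) * Real.sqrt lam := by
          rw [mul_right_comm, Real.mul_self_sqrt hlam.le]
        _ ≤ _ := by gcongr
    rw [h1, h2]; linarith
  have hsp : 0 < β + Real.sqrt lam := by have := Real.sqrt_pos.2 hlam; linarith
  rw [lt_div_iff₀ (Real.sqrt_pos.2 hκ)]
  rcases (norm_nonneg y).eq_or_lt with h0 | h0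
  · rw [← h0, zero_mul]; exact hsp
  have hTy : 0 < ‖T y‖ := lt_of_lt_of_le (mul_pos (Real.sqrt_pos.2 hlam) h0) hsl
  have h7 : ‖T y‖ ≤ β + Real.sqrt lam := by
    rw [sq] at hmain; exact le_of_mul_le_mul_left hmain hTy
  -- Strictness comes from the regularization: for `y ≠ 0` the term `lam ‖y‖²` separates `√κ ‖y‖`
  -- from `‖T y‖`.
  refine lt_of_lt_of_le ?_ h7
  refine lt_of_pow_lt_pow_left₀ 2 (norm_nonneg _) ?_
  rw [mul_pow, Real.sq_sqrt hκ.le]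
  nlinarith [mul_pos hlam (pow_pos h0 2)]

end Gram

/-! ### Gaussian integrals -/

/-- The Gaussian integral `∫ exp (-‖x‖² / 2) dx`. -/
def gaussMass (d : ℕ) : ENNReal := ∫⁻ x : Vec d, ENNReal.ofReal (Real.exp (-(‖x‖ ^ 2 / 2)))

lemma gaussMass_ne_top (d : ℕ) : gaussMass d ≠ ⊤ := by
  have h := GaussianFourier.integrable_cexp_neg_mul_sq_norm_add (V := Vec d) (b := 1 / 2)
    (by norm_num) 0 0
  have h2 : Integrable (fun x : Vec d => Real.exp (-(‖x‖ ^ 2 / 2))) := by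
    refine h.norm.congr (Filter.Eventually.of_forall fun x => ?_)
    simp only [zero_mul, add_zero, Complex.norm_exp]
    congr 1
    rw [show (-(1 / 2 : ℂ) * (‖x‖ : ℂ) ^ 2) = ((-(‖x‖ ^ 2 / 2) : ℝ) : ℂ) by push_cast; ring]
    exact Complex.ofReal_re _
  exact h2.lintegral_lt_top.ne

lemma gaussMass_ne_zero (d : ℕ) : gaussMass d ≠ 0 := by
  rw [gaussMass, Ne, lintegral_eq_zero_iff (by fun_prop)]
  intro h
  have h2 : ∀ᵐ x : Vec d, False := by
    filter_upwards [h] with x hx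
    simp only [Pi.zero_apply, ENNReal.ofReal_eq_zero] at hx
    exact absurd hx (not_le.2 (Real.exp_pos _))
  have h3 : (volume : Measure (Vec d)) = 0 := by simpa using h2
  exact NeZero.ne _ h3

lemma lintegral_exp_neg_norm_linearMap {d : ℕ} (T : Vec d →ₗ[ℝ] Vec d)
    (hT : 0 < LinearMap.det T) :
    ∫⁻ x, ENNReal.ofReal (Real.exp (-(‖T x‖ ^ 2 / 2))) =
      ENNReal.ofReal (LinearMap.det T)⁻¹ * gaussMass d := by
  have hTm : Measurable T := T.continuous_of_finiteDimensional.measurable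
  have h := lintegral_map (μ := (volume : Measure (Vec d))) (g := T)
    (f := fun x : Vec d => ENNReal.ofReal (Real.exp (-(‖x‖ ^ 2 / 2)))) (by fun_prop) hTm
  rw [← h, Measure.map_linearMap_addHaar_eq_smul_addHaar _ hT.ne', lintegral_smul_measure,
    abs_of_pos (inv_pos.2 hT), gaussMass, smul_eq_mul]

/-- The exponential of a quadratic with linear part `⟪·, S⟫`, integrated against Lebesgue
measure. -/
lemma lintegral_exp_inner_sub {d N : ℕ} {lam : ℝ} (hlam : 0 < lam) (a : Fin N → Vec d)
    {w S : Vec d} (hw : Matrix.toEuclideanLin (ridgeGram lam a) w = S) :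
    ∫⁻ x : Vec d, ENNReal.ofReal
        (Real.exp (⟪x, S⟫ - (∑ i, ⟪a i, x⟫ ^ 2) / 2 - lam * ‖x‖ ^ 2 / 2)) =
      ENNReal.ofReal (Real.exp (⟪w, S⟫ / 2) * (Real.sqrt (ridgeGram lam a).det)⁻¹) *
        gaussMass d := by
  obtain ⟨T, hT0, hdet, hT⟩ := exists_sqrt_ridgeGram a hlam
  have hTn : ∀ x, ‖T x‖ ^ 2 = lam * ‖x‖ ^ 2 + ∑ i, ⟪a i, x⟫ ^ 2 := fun x => by
    rw [← real_inner_self_eq_norm_sq, hT, real_inner_self_eq_norm_sq]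
    simp [sq]
  have hTS : ∀ x, ⟪T x, T w⟫ = ⟪x, S⟫ := fun x => by
    rw [hT, ← inner_toEuclideanLin_ridgeGram, hw]
  rw [← hdet, Real.sqrt_sq hT0.le, ENNReal.ofReal_mul (Real.exp_pos _).le, mul_assoc,
    ← lintegral_exp_neg_norm_linearMap T hT0, ← lintegral_const_mul' _ _ ENNReal.ofReal_ne_top]
  -- Completing the square: the quadratic is centred at `w`, and Lebesgue measure is invariant under
  -- this translation.
  rw [← lintegral_sub_right_eq_self
    (fun x : Vec d => ENNReal.ofReal (Real.exp (⟪w, S⟫ / 2)) *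
      ENNReal.ofReal (Real.exp (-(‖T x‖ ^ 2 / 2)))) w]
  refine lintegral_congr fun x => ?_
  rw [← ENNReal.ofReal_mul (Real.exp_pos _).le, ← Real.exp_add]
  congr 2
  have h1 : ‖T (x - w)‖ ^ 2 = ‖T x‖ ^ 2 - 2 * ⟪x, S⟫ + ⟪w, S⟫ := by
    rw [map_sub, norm_sub_sq_real, hTS, ← hTS w, real_inner_self_eq_norm_sq]
  rw [h1, hTn]; ring

lemma lintegral_exp_neg_mul_norm_sq {d : ℕ} {lam : ℝ} (hlam : 0 < lam) :
    ∫⁻ x : Vec d, ENNReal.ofReal (Real.exp (-(lam * ‖x‖ ^ 2 / 2))) =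
      ENNReal.ofReal (Real.sqrt (lam ^ d))⁻¹ * gaussMass d := by
  -- With no actions the Gram matrix is `lam • 1`.
  have h := lintegral_exp_inner_sub (d := d) (N := 0) hlam Fin.elim0 (w := 0) (S := 0) (by simp)
  simpa [ridgeGram, Matrix.det_smul] using h

/-! ### The exponential supermartingale -/

/-- Applied with the conditioning σ-algebra as the measurable structure, so that the approximants of
a predictable multiplier are predictable. -/
lemma exists_finite_range_approx {Ω : Type*} [MeasurableSpace Ω] {t : Ω → ℝ} (ht : Measurable t) :
    ∃ T : ℕ → Ω → ℝ, (∀ n, Measurable (T n)) ∧ (∀ n, ∃ R : Finset ℝ, ∀ ω, T n ω ∈ R) ∧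
      ∀ ω, Filter.Tendsto (fun n => T n ω) Filter.atTop (nhds (t ω)) :=
  ⟨fun n => ht.stronglyMeasurable.approx n, fun _ => SimpleFunc.measurable _,
    fun n => ⟨(ht.stronglyMeasurable.approx n).range, fun ω => SimpleFunc.mem_range_self _ ω⟩,
    ht.stronglyMeasurable.tendsto_approx⟩

section CondSubGaussian

variable {Ω : Type*} {m m0 : MeasurableSpace Ω} {μ : Measure Ω} [IsProbabilityMeasure μ]

/-- The measure with density `exp (t η - t² / 2)`, restricted to `m`, is dominated by `μ`. Working
with measures avoids any integrability assumption on `W`. -/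
lemma lintegral_mul_exp_const_le (hm : m ≤ m0) {η : Ω → ℝ} (hη : Measurable[m0] η) (t : ℝ)
    (hint : Integrable (fun ω => Real.exp (t * η ω)) μ)
    (hle : ∀ᵐ ω ∂μ, (μ[fun ω' => Real.exp (t * η ω') | m]) ω ≤ Real.exp (t ^ 2 / 2))
    {W : Ω → ENNReal} (hW : Measurable[m] W) :
    ∫⁻ ω, W ω * ENNReal.ofReal (Real.exp (t * η ω - t ^ 2 / 2)) ∂μ ≤ ∫⁻ ω, W ω ∂μ := by
  have hf : Measurable[m0] fun ω => ENNReal.ofReal (Real.exp (t * η ω - t ^ 2 / 2)) := by fun_prop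
  have hint' : Integrable (fun ω => Real.exp (t * η ω - t ^ 2 / 2)) μ := by
    simp_rw [Real.exp_sub]
    exact hint.div_const _
  have hle_trim : (μ.withDensity fun ω =>
      ENNReal.ofReal (Real.exp (t * η ω - t ^ 2 / 2))).trim hm ≤ μ.trim hm := by
    refine Measure.le_iff.2 fun A hA => ?_
    rw [trim_measurableSet_eq hm hA, trim_measurableSet_eq hm hA,
      withDensity_apply _ (hm A hA),
      ← ofReal_integral_eq_lintegral_ofReal hint'.integrableOn
        (Filter.Eventually.of_forall fun ω => (Real.exp_pos _).le)]
    refine ENNReal.ofReal_le_of_le_toReal ?_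
    calc ∫ ω in A, Real.exp (t * η ω - t ^ 2 / 2) ∂μ
        = (∫ ω in A, Real.exp (t * η ω) ∂μ) / Real.exp (t ^ 2 / 2) := by
          simp_rw [Real.exp_sub]; rw [integral_div]
      _ = (∫ ω in A, (μ[fun ω' => Real.exp (t * η ω') | m]) ω ∂μ) / Real.exp (t ^ 2 / 2) := by
          rw [setIntegral_condExp hm hint hA]
      _ ≤ (∫ _ω in A, Real.exp (t ^ 2 / 2) ∂μ) / Real.exp (t ^ 2 / 2) := by
          refine div_le_div_of_nonneg_right (setIntegral_mono_ae ?_ ?_ ?_) (Real.exp_pos _).le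
          · exact integrable_condExp.integrableOn
          · exact integrableOn_const (measure_ne_top _ _)
          · exact hle
      _ = (μ A).toReal := by
          rw [setIntegral_const, smul_eq_mul, mul_div_assoc, div_self (Real.exp_pos _).ne', mul_one]
          rfl
  calc ∫⁻ ω, W ω * ENNReal.ofReal (Real.exp (t * η ω - t ^ 2 / 2)) ∂μ
      = ∫⁻ ω, W ω ∂(μ.withDensity fun ω =>
          ENNReal.ofReal (Real.exp (t * η ω - t ^ 2 / 2))) := by
        rw [lintegral_withDensity_eq_lintegral_mul _ hf (hW.mono hm le_rfl)]
        simp [mul_comm]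
    _ = ∫⁻ ω, W ω ∂((μ.withDensity fun ω =>
          ENNReal.ofReal (Real.exp (t * η ω - t ^ 2 / 2))).trim hm) := (lintegral_trim hm hW).symm
    _ ≤ ∫⁻ ω, W ω ∂(μ.trim hm) := lintegral_mono' hle_trim le_rfl
    _ = ∫⁻ ω, W ω ∂μ := lintegral_trim hm hW

/-- Split according to the value of `t`: on each `m`-measurable level set the multiplier is
constant. -/
lemma lintegral_mul_exp_simpleFunc_le (hm : m ≤ m0) {η : Ω → ℝ} (hη : Measurable[m0] η)
    (hint : ∀ t : ℝ, Integrable (fun ω => Real.exp (t * η ω)) μ)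
    (hle : ∀ t : ℝ, ∀ᵐ ω ∂μ,
      (μ[fun ω' => Real.exp (t * η ω') | m]) ω ≤ Real.exp (t ^ 2 / 2))
    {W : Ω → ENNReal} (hW : Measurable[m] W) {t : Ω → ℝ}
    (ht : Measurable[m] t) {R : Finset ℝ} (hR : ∀ ω, t ω ∈ R) :
    ∫⁻ ω, W ω * ENNReal.ofReal (Real.exp (t ω * η ω - t ω ^ 2 / 2)) ∂μ ≤ ∫⁻ ω, W ω ∂μ := by
  classical
  have hmeas : ∀ k, MeasurableSet[m] (t ⁻¹' {k}) := fun k => ht (measurableSet_singleton k)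
  have hind : ∀ k, Measurable[m] ((t ⁻¹' {k}).indicator W) := fun k => hW.indicator (hmeas k)
  have hdecomp : ∀ (F : ℝ → Ω → ENNReal) (ω : Ω),
      F (t ω) ω = ∑ k ∈ R, (t ⁻¹' {k}).indicator (F k) ω := fun F ω => by
    rw [Finset.sum_eq_single (t ω)]
    · simp
    · intro k _ hk
      exact indicator_of_notMem (fun h => hk (by simpa using h.symm)) _
    · intro h; exact absurd (hR ω) h
  calc ∫⁻ ω, W ω * ENNReal.ofReal (Real.exp (t ω * η ω - t ω ^ 2 / 2)) ∂μ
      = ∫⁻ ω, ∑ k ∈ R, (t ⁻¹' {k}).indicator W ω *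
          ENNReal.ofReal (Real.exp (k * η ω - k ^ 2 / 2)) ∂μ := by
        refine lintegral_congr fun ω => ?_
        rw [hdecomp (fun k ω => W ω * ENNReal.ofReal (Real.exp (k * η ω - k ^ 2 / 2))) ω]
        exact Finset.sum_congr rfl fun k _ => by rw [indicator_mul_left]
    _ = ∑ k ∈ R, ∫⁻ ω, (t ⁻¹' {k}).indicator W ω *
          ENNReal.ofReal (Real.exp (k * η ω - k ^ 2 / 2)) ∂μ := by
        refine lintegral_finsetSum _ fun k _ => ?_
        exact ((hind k).mono hm le_rfl).mul (by fun_prop)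
    _ ≤ ∑ k ∈ R, ∫⁻ ω, (t ⁻¹' {k}).indicator W ω ∂μ :=
        Finset.sum_le_sum fun k _ =>
          lintegral_mul_exp_const_le hm hη k (hint k) (hle k) (hind k)
    _ = ∫⁻ ω, W ω ∂μ := by
        rw [← lintegral_finsetSum _ fun k _ => (hind k).mono hm le_rfl]
        exact lintegral_congr fun ω => (hdecomp (fun _ => W) ω).symm

/-- A conditionally sub-Gaussian variable stays sub-Gaussian under a predictable multiplier. -/
lemma lintegral_mul_exp_le (hm : m ≤ m0) {η : Ω → ℝ} (hη : Measurable[m0] η)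
    (hint : ∀ t : ℝ, Integrable (fun ω => Real.exp (t * η ω)) μ)
    (hle : ∀ t : ℝ, ∀ᵐ ω ∂μ,
      (μ[fun ω' => Real.exp (t * η ω') | m]) ω ≤ Real.exp (t ^ 2 / 2))
    {W : Ω → ENNReal} (hW : Measurable[m] W) {t : Ω → ℝ} (ht : Measurable[m] t) :
    ∫⁻ ω, W ω * ENNReal.ofReal (Real.exp (t ω * η ω - t ω ^ 2 / 2)) ∂μ ≤ ∫⁻ ω, W ω ∂μ := by
  obtain ⟨T, hTm, hTR, hTlim⟩ := @exists_finite_range_approx Ω m t ht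
  have hlim : ∀ ω, Filter.Tendsto
      (fun n => W ω * ENNReal.ofReal (Real.exp (T n ω * η ω - T n ω ^ 2 / 2))) Filter.atTop
      (nhds (W ω * ENNReal.ofReal (Real.exp (t ω * η ω - t ω ^ 2 / 2)))) := fun ω => by
    refine ENNReal.Tendsto.const_mul ?_ (Or.inl ?_)
    · have hc : Continuous fun s : ℝ => ENNReal.ofReal (Real.exp (s * η ω - s ^ 2 / 2)) := by
        exact ENNReal.continuous_ofReal.comp (by fun_prop)
      exact (hc.tendsto _).comp (hTlim ω)
    · simpa using Real.exp_pos _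
  calc ∫⁻ ω, W ω * ENNReal.ofReal (Real.exp (t ω * η ω - t ω ^ 2 / 2)) ∂μ
      = ∫⁻ ω, Filter.liminf (fun n =>
          W ω * ENNReal.ofReal (Real.exp (T n ω * η ω - T n ω ^ 2 / 2))) Filter.atTop ∂μ :=
        lintegral_congr fun ω => (hlim ω).liminf_eq.symm
    -- Fatou's lemma suffices, since only an upper bound is needed.
    _ ≤ Filter.liminf (fun n => ∫⁻ ω,
          W ω * ENNReal.ofReal (Real.exp (T n ω * η ω - T n ω ^ 2 / 2)) ∂μ) Filter.atTop := by
        refine lintegral_liminf_le fun n => ?_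
        have hTn : Measurable[m0] (T n) := (hTm n).mono hm le_rfl
        have hWm : Measurable[m0] W := hW.mono hm le_rfl
        fun_prop
    _ ≤ ∫⁻ ω, W ω ∂μ := by
        refine (Filter.liminf_le_liminf (v := fun _ => ∫⁻ ω, W ω ∂μ)
          (Filter.Eventually.of_forall fun n => ?_)).trans_eq (Filter.liminf_const _)
        exact lintegral_mul_exp_simpleFunc_le hm hη hint hle hW (hTm n) (hTR n).choose_spec

end CondSubGaussian

/-! ### The noise vector and its exponential moments -/

section Noise

variable {Ω : Type*} [MeasurableSpace Ω] {μ : Measure Ω} [IsProbabilityMeasure μ] {U d : ℕ}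
  (D : Dataset Ω U d) (θ : Fin U → Vec d) (u : Fin U)

/-- The noise part `∑ᵢ (rᵢ - ⟪θ, aᵢ⟫) aᵢ` of the reward-weighted sum of actions. -/
def Dataset.noise (ω : Ω) : Vec d :=
  ∑ i, (D.reward u i ω - ⟪θ u, D.action u i ω⟫) • D.action u i ω

lemma Dataset.history_le (i : Fin (D.N u)) : D.history u i ≤ ‹MeasurableSpace Ω› := by
  refine sup_le (iSup_le fun j => iSup_le fun _ => ?_) (iSup_le fun j => iSup_le fun _ => ?_)
  · exact (D.measurable_action u j).comap_le
  · exact (D.measurable_reward u j).comap_le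

lemma Dataset.measurable_action_history {i j : Fin (D.N u)} (h : j ≤ i) :
    Measurable[D.history u i] (D.action u j) :=
  (comap_measurable (D.action u j)).mono
    (le_sup_of_le_left (le_iSup_of_le j (le_iSup_of_le h le_rfl))) le_rfl

lemma Dataset.measurable_reward_history {i j : Fin (D.N u)} (h : j < i) :
    Measurable[D.history u i] (D.reward u j) :=
  (comap_measurable (D.reward u j)).mono
    (le_sup_of_le_right (le_iSup_of_le j (le_iSup_of_le h le_rfl))) le_rfl

variable {D θ}

/-- Supermartingale property, peeling off the last round. The history of a round contains its own
action but not its reward, so both the earlier factors and the multiplier `⟪a, x⟫` are measurable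
with respect to it. -/
lemma lintegral_prod_exp_le_one (hrew : SubGaussianRewards μ D θ) (x : Vec d) (k : ℕ)
    (hk : k ≤ D.N u) :
    ∫⁻ ω, ∏ i ∈ Finset.univ.filter (fun i : Fin (D.N u) => (i : ℕ) < k),
      ENNReal.ofReal (Real.exp (⟪D.action u i ω, x⟫ *
        (D.reward u i ω - ⟪θ u, D.action u i ω⟫) - ⟪D.action u i ω, x⟫ ^ 2 / 2)) ∂μ ≤ 1 := by
  induction k with
  | zero => simp
  | succ k ih =>
    set i0 : Fin (D.N u) := ⟨k, hk⟩ with hi0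
    have hfil : Finset.univ.filter (fun i : Fin (D.N u) => (i : ℕ) < k + 1) =
        insert i0 (Finset.univ.filter (fun i : Fin (D.N u) => (i : ℕ) < k)) := by
      ext i
      simp only [Finset.mem_filter, Finset.mem_univ, true_and, Finset.mem_insert, hi0,
        Fin.ext_iff]
      omega
    have hni : i0 ∉ Finset.univ.filter (fun i : Fin (D.N u) => (i : ℕ) < k) := by simp [hi0]
    simp_rw [hfil, Finset.prod_insert hni]
    refine le_trans ?_ (ih (by omega))
    simp_rw [mul_comm (ENNReal.ofReal _)]
    refine lintegral_mul_exp_le (D.history_le u i0)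
      (η := fun ω => D.reward u i0 ω - ⟪θ u, D.action u i0 ω⟫)
      (t := fun ω => ⟪D.action u i0 ω, x⟫) ?_ (fun t => (hrew u i0 t).1)
      (fun t => (hrew u i0 t).2) ?_ ?_
    · have h1 := D.measurable_action u i0
      have h2 := D.measurable_reward u i0
      fun_prop
    · refine Finset.measurable_prod _ fun j hj => ?_
      have hj' : j < i0 := by simpa [hi0, Fin.lt_def] using hj
      have h1 := D.measurable_action_history u hj'.le
      have h2 := D.measurable_reward_history u hj'
      fun_prop
    · have h1 := D.measurable_action_history u (le_refl i0)
      fun_prop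

lemma lintegral_exp_inner_noise_le_one (hrew : SubGaussianRewards μ D θ) (x : Vec d) :
    ∫⁻ ω, ENNReal.ofReal (Real.exp (⟪x, D.noise θ u ω⟫ -
      (∑ i, ⟪D.action u i ω, x⟫ ^ 2) / 2)) ∂μ ≤ 1 := by
  refine le_trans (le_of_eq ?_) (lintegral_prod_exp_le_one u hrew x (D.N u) le_rfl)
  refine lintegral_congr fun ω => ?_
  rw [← ENNReal.ofReal_prod_of_nonneg fun _ _ => (Real.exp_pos _).le, ← Real.exp_sum]
  congr 2
  rw [Finset.filter_true_of_mem fun i _ => i.2, Finset.sum_sub_distrib, Finset.sum_div,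
    Dataset.noise, inner_sum]
  congr 1
  refine Finset.sum_congr rfl fun i _ => ?_
  rw [inner_smul_right, mul_comm, real_inner_comm x]

end Noise

/-! ### The self-normalized tail bound -/

section SelfNormalized

variable {Ω : Type*} [MeasurableSpace Ω] {μ : Measure Ω} {U d : ℕ} {D : Dataset Ω U d}
  {θ : Fin U → Vec d}

lemma SelectedFromCandidates.ae_norm_action_le_one {ρ : Measure (Vec d)} {lamA σ : ℝ} {S : ℕ}
    (hρ : RegularLaw ρ lamA σ) (hsel : SelectedFromCandidates μ D ρ S) (u : Fin U) :
    ∀ᵐ ω ∂μ, ∀ i, ‖D.action u i ω‖ ≤ 1 := by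
  obtain ⟨K, c, -, hcm, -, hlaw, hact⟩ := hsel u
  refine ae_all_iff.2 fun i => ?_
  have h1 : ∀ᵐ ω ∂μ, ∀ k, ‖c i k ω‖ ≤ 1 := by
    refine ae_all_iff.2 fun k => ?_
    have := hρ.norm_le_one
    rw [← hlaw i k] at this
    exact ae_of_ae_map (hcm i k).aemeasurable this
  filter_upwards [h1, hact i] with ω hω hk
  obtain ⟨k, hk⟩ := hk
  rw [hk]; exact hω k

lemma Dataset.measurable_noise (u : Fin U) : Measurable (D.noise θ u) := by
  have h1 := D.measurable_action u
  have h2 := D.measurable_reward u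
  unfold Dataset.noise
  fun_prop

variable [IsProbabilityMeasure μ]

/-- Tonelli: for fixed `x` the expectation is at most the Gaussian weight `exp (-lam ‖x‖² / 2)`. The
weight is left unnormalized; `gaussMass` cancels later. -/
lemma lintegral_lintegral_exp_noise_le (hrew : SubGaussianRewards μ D θ) {lam : ℝ} (hlam : 0 < lam)
    (u : Fin U) :
    ∫⁻ ω, (∫⁻ x : Vec d, ENNReal.ofReal (Real.exp (⟪x, D.noise θ u ω⟫ -
      (∑ i, ⟪D.action u i ω, x⟫ ^ 2) / 2 - lam * ‖x‖ ^ 2 / 2))) ∂μ ≤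
      ENNReal.ofReal (Real.sqrt (lam ^ d))⁻¹ * gaussMass d := by
  have h1 := D.measurable_action u
  have h2 := D.measurable_noise (θ := θ) u
  rw [lintegral_lintegral_swap (by fun_prop), ← lintegral_exp_neg_mul_norm_sq hlam]
  refine lintegral_mono fun x => ?_
  simp_rw [sub_eq_add_neg _ (lam * ‖x‖ ^ 2 / 2), Real.exp_add,
    ENNReal.ofReal_mul (Real.exp_pos _).le]
  rw [lintegral_mul_const' _ _ ENNReal.ofReal_ne_top]
  exact mul_le_of_le_one_left' (lintegral_exp_inner_noise_le_one u hrew x)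

/-- Method of mixtures. The mixture `Z` equals `exp (‖noise‖² / 2) / √det M` up to `gaussMass`, with
the norm taken in `M⁻¹`. On the bad event the determinant bound makes it at least `c`, which is `1 /
ε` times the bound on its expectation. The sample size is fixed, so Markov's inequality is enough.
-/
lemma measure_selfNormalized_gt_le (hrew : SubGaussianRewards μ D θ) (hd : 0 < d) {lam : ℝ}
    (hlam : 0 < lam) (u : Fin U) (hnorm : ∀ᵐ ω ∂μ, ∀ i, ‖D.action u i ω‖ ≤ 1)
    {ε : ℝ} (hε : 0 < ε) (w : Ω → Vec d)
    (hw : ∀ ω, Matrix.toEuclideanLin (ridgeGram lam fun i => D.action u i ω) (w ω) =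
      D.noise θ u ω) :
    μ {ω | d * Real.log (1 + D.N u / (lam * d)) + 2 * Real.log (1 / ε) <
      ⟪w ω, D.noise θ u ω⟫} ≤ ENNReal.ofReal ε := by
  have hd' : (0 : ℝ) < d := by exact_mod_cast hd
  have hld : 0 < Real.sqrt (lam ^ d) := Real.sqrt_pos.2 (pow_pos hlam d)
  set Z : Ω → ENNReal := fun ω => ∫⁻ x : Vec d, ENNReal.ofReal (Real.exp (⟪x, D.noise θ u ω⟫ -
      (∑ i, ⟪D.action u i ω, x⟫ ^ 2) / 2 - lam * ‖x‖ ^ 2 / 2)) with hZ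
  have hZm : Measurable Z := by
    have h1 := D.measurable_action u
    have h2 := D.measurable_noise (θ := θ) u
    exact Measurable.lintegral_prod_right' (f := fun p : Ω × Vec d =>
      ENNReal.ofReal (Real.exp (⟪p.2, D.noise θ u p.1⟫ -
      (∑ i, ⟪D.action u i p.1, p.2⟫ ^ 2) / 2 - lam * ‖p.2‖ ^ 2 / 2))) (by fun_prop)
  set c : ENNReal := ENNReal.ofReal (1 / ε * (Real.sqrt (lam ^ d))⁻¹) * gaussMass d with hc
  have hpos : 0 < 1 / ε * (Real.sqrt (lam ^ d))⁻¹ := by positivity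
  have hc0 : c ≠ 0 := mul_ne_zero (by simpa using hpos) (gaussMass_ne_zero d)
  have hcT : c ≠ ⊤ := ENNReal.mul_ne_top ENNReal.ofReal_ne_top (gaussMass_ne_top d)
  have hsub : ∀ᵐ ω ∂μ, ω ∈ {ω | d * Real.log (1 + D.N u / (lam * d)) + 2 * Real.log (1 / ε) <
      ⟪w ω, D.noise θ u ω⟫} → ω ∈ {ω | c ≤ Z ω} := by
    filter_upwards [hnorm] with ω hω hbad
    change _ < _ at hbad
    rw [hZ, hc]
    simp only
    rw [lintegral_exp_inner_sub hlam (fun i => D.action u i ω) (hw ω)]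
    gcongr ENNReal.ofReal ?_ * _
    set r : ℝ := 1 + D.N u / (lam * d) with hr
    have hr0 : 0 < r := by positivity
    have hdet := (ridgeGram_posDef (fun i => D.action u i ω) hlam).det_pos
    have hdet_le : Real.sqrt (ridgeGram lam fun i => D.action u i ω).det ≤
        Real.sqrt (r ^ d) * Real.sqrt (lam ^ d) := by
      rw [← Real.sqrt_mul (by positivity), ← mul_pow]
      refine Real.sqrt_le_sqrt ((det_ridgeGram_le _ hd hlam hω).trans_eq ?_)
      congr 1
      rw [hr]; field_simp
    have hexp : 1 / ε * Real.sqrt (r ^ d) ≤ Real.exp (⟪w ω, D.noise θ u ω⟫ / 2) := by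
      have h1 : 1 / ε * Real.sqrt (r ^ d) =
          Real.exp ((d * Real.log r + 2 * Real.log (1 / ε)) / 2) := by
        rw [show (d * Real.log r + 2 * Real.log (1 / ε)) / 2 =
          Real.log (1 / ε) + d * Real.log r / 2 by ring, Real.exp_add,
          Real.exp_log (by positivity), Real.exp_half, mul_comm (d : ℝ), Real.exp_mul,
          Real.exp_log hr0, Real.rpow_natCast]
      rw [h1]
      gcongr
    calc 1 / ε * (Real.sqrt (lam ^ d))⁻¹
        = (1 / ε * Real.sqrt (r ^ d)) * (Real.sqrt (r ^ d) * Real.sqrt (lam ^ d))⁻¹ := by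
          have : 0 < Real.sqrt (r ^ d) := Real.sqrt_pos.2 (by positivity)
          field_simp
      _ ≤ _ := by
          gcongr
  calc _ ≤ μ {ω | c ≤ Z ω} := measure_mono_ae hsub
    _ ≤ (∫⁻ ω, Z ω ∂μ) / c := meas_ge_le_lintegral_div hZm.aemeasurable hc0 hcT
    _ ≤ ENNReal.ofReal ε := by
      rw [ENNReal.div_le_iff hc0 hcT]
      refine (lintegral_lintegral_exp_noise_le hrew hlam u).trans_eq ?_
      rw [hc, ← mul_assoc, ← ENNReal.ofReal_mul hε.le]
      congr 2
      field_simp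

end SelfNormalized

/-! ### The action distribution -/

section RegularLaw

variable {d : ℕ} {ρ : Measure (Vec d)} {lamA σ : ℝ}

lemma RegularLaw.dim_pos (hρ : RegularLaw ρ lamA σ) : 0 < d := by
  rcases Nat.eq_zero_or_pos d with rfl | h
  -- In dimension 0 the spectrum is empty and has no least element.
  · have := hρ.isLeast_eigenvalue.1
    rw [spectrum.of_subsingleton] at this
    exact absurd this (Set.notMem_empty _)
  · exact h

lemma RegularLaw.integrable_coord_mul (hρ : RegularLaw ρ lamA σ) (i j : Fin d) :
    Integrable (fun a : Vec d => a i * a j) ρ := by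
  have := hρ.isProbability
  refine Integrable.of_bound (by fun_prop) 1 ?_
  filter_upwards [hρ.norm_le_one] with a ha
  rw [norm_mul]
  exact mul_le_one₀ ((PiLp.norm_apply_le a i).trans ha) (norm_nonneg _)
    ((PiLp.norm_apply_le a j).trans ha)

lemma RegularLaw.integral_inner_sq (hρ : RegularLaw ρ lamA σ) (x : Vec d) :
    ∫ b, ⟪x, b⟫ ^ 2 ∂ρ = x.ofLp ⬝ᵥ (Matrix.mulVec (secondMoment ρ) x.ofLp) := by
  have h : ∀ b : Vec d, ⟪x, b⟫ ^ 2 = ∑ i, ∑ j, x i * x j * (b i * b j) := fun b => by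
    rw [sq, PiLp.inner_apply, Finset.sum_mul_sum]
    refine Finset.sum_congr rfl fun i _ => Finset.sum_congr rfl fun j _ => ?_
    simp; ring
  simp_rw [h]
  rw [integral_finsetSum _ fun i _ => integrable_finsetSum _ fun j _ =>
    (hρ.integrable_coord_mul i j).const_mul _]
  refine Finset.sum_congr rfl fun i _ => ?_
  rw [integral_finsetSum _ fun j _ => (hρ.integrable_coord_mul i j).const_mul _,
    Matrix.mulVec, dotProduct, Finset.mul_sum]
  refine Finset.sum_congr rfl fun j _ => ?_
  rw [integral_const_mul, secondMoment, Matrix.of_apply]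
  ring

lemma RegularLaw.le_integral_inner_sq (hρ : RegularLaw ρ lamA σ) (x : Vec d) :
    lamA * ‖x‖ ^ 2 ≤ ∫ b, ⟪x, b⟫ ^ 2 ∂ρ := by
  have hherm : (secondMoment ρ).IsHermitian := by
    ext i j
    simp [secondMoment, mul_comm]
  have hpsd : (secondMoment ρ - lamA • (1 : Matrix (Fin d) (Fin d) ℝ)).PosSemidef := by
    rw [Matrix.posSemidef_iff_isHermitian_and_spectrum_nonneg]
    refine ⟨hherm.sub (by simp [Matrix.IsHermitian]), fun t ht => ?_⟩
    rw [← Algebra.algebraMap_eq_smul_one, ← spectrum.sub_singleton_eq] at ht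
    obtain ⟨s, hs, r, rfl, rfl⟩ := ht
    exact sub_nonneg.2 (hρ.isLeast_eigenvalue.2 hs)
  have h := hpsd.dotProduct_mulVec_nonneg x.ofLp
  rw [Matrix.sub_mulVec, dotProduct_sub, Matrix.smul_mulVec, Matrix.one_mulVec, dotProduct_smul,
    sub_nonneg] at h
  rw [hρ.integral_inner_sq]
  have h2 : star x.ofLp ⬝ᵥ x.ofLp = ‖x‖ ^ 2 := by
    rw [← real_inner_self_eq_norm_sq, PiLp.inner_apply]
    simp [dotProduct, sq]
  rw [h2] at h
  simpa using h

/-- The trace of the second moment matrix is at most 1 on the unit ball. This yields `lamT * d ≤ 1`,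
by which `N_min`, only logarithmic in `d`, beats a net of exponential size in `d`. -/
lemma RegularLaw.lamA_mul_dim_le_one (hρ : RegularLaw ρ lamA σ) : lamA * d ≤ 1 := by
  have := hρ.isProbability
  have h1 : ∀ i : Fin d, lamA ≤ ∫ b, b i * b i ∂ρ := fun i => by
    have := hρ.le_integral_inner_sq (EuclideanSpace.single i (1 : ℝ))
    simpa [EuclideanSpace.inner_single_left, sq] using this
  calc lamA * d = ∑ _i : Fin d, lamA := by simp [mul_comm]
    _ ≤ ∑ i : Fin d, ∫ b, b i * b i ∂ρ := Finset.sum_le_sum fun i _ => h1 i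
    _ = ∫ b, ∑ i : Fin d, b i * b i ∂ρ :=
        (integral_finsetSum _ fun i _ => hρ.integrable_coord_mul i i).symm
    _ ≤ ∫ _b, (1 : ℝ) ∂ρ := by
        refine integral_mono_ae (integrable_finsetSum _ fun i _ => hρ.integrable_coord_mul i i)
          (integrable_const _) ?_
        filter_upwards [hρ.norm_le_one] with b hb
        have h2 := real_inner_self_eq_norm_sq b
        rw [PiLp.inner_apply] at h2
        have h3 : ‖b‖ ^ 2 ≤ 1 := pow_le_one₀ (norm_nonneg _) hb
        simpa [← sq] using h2.trans_le h3
    _ = 1 := by simp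

lemma RegularLaw.measure_inner_sq_le (hρ : RegularLaw ρ lamA σ) {x : Vec d} (hx : ‖x‖ = 1) {t : ℝ}
    (ht : t ≤ lamA) :
    ρ.real {a | ⟪x, a⟫ ^ 2 ≤ t} ≤ Real.exp (-(lamA - t) ^ 2 / (2 * σ ^ 2)) := by
  have h1 : lamA ≤ ∫ b, ⟪x, b⟫ ^ 2 ∂ρ := by simpa [hx] using hρ.le_integral_inner_sq x
  have h2 := hρ.lower_tail x hx ((∫ b, ⟪x, b⟫ ^ 2 ∂ρ) - t) (by linarith)
  rw [sub_sub_cancel] at h2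
  refine h2.trans (Real.exp_le_exp.2 ?_)
  have hσ := hρ.sigma_pos
  gcongr

end RegularLaw

/-! ### Bounds on the smoothed regularity parameter -/

section SmoothedRegularity

lemma smoothedIntegrand_mem_Icc (lamA σ x : ℝ) (S : ℕ) :
    (1 - Real.exp (-(lamA - x) ^ 2 / (2 * σ ^ 2))) ^ S ∈ Icc (0 : ℝ) 1 := by
  have h : Real.exp (-(lamA - x) ^ 2 / (2 * σ ^ 2)) ≤ 1 := by
    rw [Real.exp_le_one_iff]
    exact div_nonpos_of_nonpos_of_nonneg (by nlinarith [sq_nonneg (lamA - x)]) (by positivity)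
  have h' := Real.exp_pos (-(lamA - x) ^ 2 / (2 * σ ^ 2))
  exact ⟨pow_nonneg (by linarith) _, pow_le_one₀ (by linarith) (by linarith)⟩

lemma continuous_smoothedIntegrand (lamA σ : ℝ) (S : ℕ) :
    Continuous fun x : ℝ => (1 - Real.exp (-(lamA - x) ^ 2 / (2 * σ ^ 2))) ^ S := by
  fun_prop

lemma smoothedRegularity_pos {lamA σ : ℝ} (hl : 0 < lamA) (hσ : 0 < σ) (S : ℕ) :
    0 < smoothedRegularity lamA σ S := by
  refine intervalIntegral.intervalIntegral_pos_of_pos_on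
    ((continuous_smoothedIntegrand lamA σ S).intervalIntegrable _ _) (fun x hx => ?_) hl
  have h : Real.exp (-(lamA - x) ^ 2 / (2 * σ ^ 2)) < 1 := by
    rw [Real.exp_lt_one_iff]
    have : 0 < lamA - x := by linarith [hx.2]
    exact div_neg_of_neg_of_pos (by nlinarith) (by positivity)
  exact pow_pos (by linarith) _

lemma smoothedRegularity_le {lamA σ : ℝ} (hl : 0 < lamA) (S : ℕ) :
    smoothedRegularity lamA σ S ≤ lamA := by
  calc smoothedRegularity lamA σ S ≤ ∫ _x in (0 : ℝ)..lamA, (1 : ℝ) :=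
        intervalIntegral.integral_mono_on hl.le
          ((continuous_smoothedIntegrand lamA σ S).intervalIntegrable _ _) (by simp)
          fun x _ => (smoothedIntegrand_mem_Icc lamA σ x S).2
    _ = lamA := by simp

end SmoothedRegularity

/-! ### The worst candidate of a round -/

section WorstCandidate

variable {Ω : Type*} [MeasurableSpace Ω] {μ : Measure Ω} {d : ℕ}
  {ρ : Measure (Vec d)} {lamA σ : ℝ}

/-- Layer-cake formula: by independence, `P(min ≥ t)` is a product of `K ≤ S` factors, each at least
`1 - exp (-(lamA - t)² / (2σ²))`. Integrating over `t ∈ (0, lamA]` gives the parameter. `NeZero K`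
matters because a real infimum over an empty family is 0. -/
lemma smoothedRegularity_le_lintegral_iInf (hρ : RegularLaw ρ lamA σ) {S K : ℕ} [NeZero K]
    (hKS : K ≤ S) (c : Fin K → Ω → Vec d) (hcm : ∀ k, Measurable (c k)) (hind : iIndepFun c μ)
    (hlaw : ∀ k, μ.map (c k) = ρ) {x : Vec d} (hx : ‖x‖ = 1) :
    ENNReal.ofReal (smoothedRegularity lamA σ S) ≤
      ∫⁻ ω, ENNReal.ofReal (⨅ k, ⟪x, c k ω⟫ ^ 2) ∂μ := by
  have := hρ.isProbability
  have hYm : Measurable fun ω => ⨅ k, ⟪x, c k ω⟫ ^ 2 := Measurable.iInf fun k => by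
    have := hcm k
    fun_prop
  have hY0 : ∀ ω, 0 ≤ ⨅ k, ⟪x, c k ω⟫ ^ 2 := fun ω => Real.iInf_nonneg fun k => sq_nonneg _
  rw [lintegral_eq_lintegral_meas_le μ (Filter.Eventually.of_forall hY0) hYm.aemeasurable]
  rw [smoothedRegularity, intervalIntegral.integral_of_le hρ.lamA_pos.le,
    ofReal_integral_eq_lintegral_ofReal
      ((continuous_smoothedIntegrand lamA σ S).integrableOn_Ioc)
      (Filter.Eventually.of_forall fun t => (smoothedIntegrand_mem_Icc lamA σ t S).1)]
  refine le_trans (setLIntegral_mono_ae' measurableSet_Ioc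
    (Filter.Eventually.of_forall fun t ht => ?_)) (lintegral_mono_set Ioc_subset_Ioi_self)
  have hprod : μ (⋂ k, c k ⁻¹' {a | t ≤ ⟪x, a⟫ ^ 2}) = ∏ k, μ (c k ⁻¹' {a | t ≤ ⟪x, a⟫ ^ 2}) := by
    refine hind.meas_iInter fun k => ⟨_, ?_, rfl⟩
    exact measurableSet_le measurable_const (by fun_prop)
  have hset : {ω | t ≤ ⨅ k, ⟪x, c k ω⟫ ^ 2} = ⋂ k, c k ⁻¹' {a | t ≤ ⟪x, a⟫ ^ 2} := by
    ext ω
    simp only [mem_ofPred_eq, mem_iInter, mem_preimage]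
    exact le_ciInf_iff (Set.finite_range _).bddBelow
  rw [hset, hprod]
  have hone : ∀ k, ENNReal.ofReal (1 - Real.exp (-(lamA - t) ^ 2 / (2 * σ ^ 2))) ≤
      μ (c k ⁻¹' {a | t ≤ ⟪x, a⟫ ^ 2}) := fun k => by
    rw [← Measure.map_apply (hcm k) (measurableSet_le measurable_const (by fun_prop)), hlaw k]
    refine ENNReal.ofReal_le_of_le_toReal ?_
    have h1 := hρ.measure_inner_sq_le hx ht.2
    have h2 : ρ.real {a | ⟪x, a⟫ ^ 2 ≤ t}ᶜ = 1 - ρ.real {a | ⟪x, a⟫ ^ 2 ≤ t} :=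
      probReal_compl_eq_one_sub (measurableSet_le (by fun_prop) measurable_const)
    have h3 : ρ.real {a | ⟪x, a⟫ ^ 2 ≤ t}ᶜ ≤ ρ.real {a | t ≤ ⟪x, a⟫ ^ 2} :=
      measureReal_mono fun a ha => (not_le.1 (show ¬⟪x, a⟫ ^ 2 ≤ t from ha)).le
    change _ ≤ ρ.real _
    linarith
  have hb := smoothedIntegrand_mem_Icc lamA σ t 1
  rw [pow_one] at hb
  calc ENNReal.ofReal ((1 - Real.exp (-(lamA - t) ^ 2 / (2 * σ ^ 2))) ^ S)
      ≤ ENNReal.ofReal ((1 - Real.exp (-(lamA - t) ^ 2 / (2 * σ ^ 2))) ^ K) :=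
        ENNReal.ofReal_le_ofReal (pow_le_pow_of_le_one hb.1 hb.2 hKS)
    _ = ∏ _k : Fin K, ENNReal.ofReal (1 - Real.exp (-(lamA - t) ^ 2 / (2 * σ ^ 2))) := by
        rw [ENNReal.ofReal_pow hb.1]; simp
    _ ≤ _ := Finset.prod_le_prod' fun k _ => hone k

/-- A chord of the convex exponential between `0` and `-1/2`; `39/64` is a rational upper bound for
`exp (-1/2)`, and `25/64 = 1 - 39/64`. -/
lemma exp_neg_half_mul_le {y : ℝ} (h0 : 0 ≤ y) (h1 : y ≤ 1) :
    Real.exp (-(y / 2)) ≤ 1 - 25 / 64 * y := by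
  have hconv := convexOn_exp.2 (mem_univ (0 : ℝ)) (mem_univ (-(1 / 2) : ℝ))
    (sub_nonneg.2 h1) h0 (sub_add_cancel 1 y)
  simp only [smul_eq_mul, mul_zero, zero_add, Real.exp_zero, mul_one] at hconv
  have he : Real.exp (-(1 / 2)) ≤ 39 / 64 := by
    have h2 : Real.exp (-(1 / 2)) ^ 2 * Real.exp 1 = 1 := by
      rw [← Real.exp_nat_mul, ← Real.exp_add]; norm_num
    have h3 := Real.exp_one_gt_d9
    have h4 := Real.exp_pos (-(1 / 2))
    by_contra hcon
    push Not at hcon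
    nlinarith [mul_lt_mul'' hcon hcon (by norm_num) (by norm_num)]
  rw [show -(y / 2) = y * -(1 / 2) by ring]
  nlinarith

variable [IsProbabilityMeasure μ]

/-- On `[0, 1]` the chord bound linearizes the exponential, so only the mean of the minimum enters.
-/
lemma lintegral_exp_neg_iInf_le (hρ : RegularLaw ρ lamA σ) {S K : ℕ} [NeZero K]
    (hKS : K ≤ S) (c : Fin K → Ω → Vec d) (hcm : ∀ k, Measurable (c k)) (hind : iIndepFun c μ)
    (hlaw : ∀ k, μ.map (c k) = ρ) {x : Vec d} (hx : ‖x‖ = 1) :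
    ∫⁻ ω, ENNReal.ofReal (Real.exp (-((⨅ k, ⟪x, c k ω⟫ ^ 2) / 2))) ∂μ ≤
      ENNReal.ofReal (Real.exp (-(25 / 64 * smoothedRegularity lamA σ S))) := by
  set Y : Ω → ℝ := fun ω => ⨅ k, ⟪x, c k ω⟫ ^ 2 with hY
  have hYm : Measurable Y := Measurable.iInf fun k => by
    have := hcm k
    fun_prop
  have hY0 : ∀ ω, 0 ≤ Y ω := fun ω => Real.iInf_nonneg fun k => sq_nonneg _
  have hY1 : ∀ᵐ ω ∂μ, Y ω ≤ 1 := by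
    have h := hρ.norm_le_one
    rw [← hlaw 0] at h
    filter_upwards [ae_of_ae_map (hcm 0).aemeasurable h] with ω hω
    refine (ciInf_le (Set.finite_range _).bddBelow 0).trans ?_
    rw [← sq_abs]
    refine pow_le_one₀ (abs_nonneg _) ((abs_real_inner_le_norm _ _).trans ?_)
    rw [hx, one_mul]; exact hω
  have hYi : Integrable Y μ := by
    refine Integrable.of_bound hYm.aestronglyMeasurable 1 ?_
    filter_upwards [hY1] with ω hω
    rwa [Real.norm_of_nonneg (hY0 ω)]
  have hEY : smoothedRegularity lamA σ S ≤ ∫ ω, Y ω ∂μ := by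
    have h := smoothedRegularity_le_lintegral_iInf hρ hKS c hcm hind hlaw hx
    rw [← ofReal_integral_eq_lintegral_ofReal hYi (Filter.Eventually.of_forall hY0)] at h
    exact (ENNReal.ofReal_le_ofReal_iff (integral_nonneg hY0)).1 h
  have hEi : Integrable (fun ω => Real.exp (-(Y ω / 2))) μ := by
    refine Integrable.of_bound (by fun_prop) 1 (Filter.Eventually.of_forall fun ω => ?_)
    rw [Real.norm_of_nonneg (Real.exp_pos _).le, Real.exp_le_one_iff]
    linarith [hY0 ω]
  rw [← ofReal_integral_eq_lintegral_ofReal hEi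
    (Filter.Eventually.of_forall fun ω => (Real.exp_pos _).le)]
  refine ENNReal.ofReal_le_ofReal ?_
  calc ∫ ω, Real.exp (-(Y ω / 2)) ∂μ ≤ ∫ ω, (1 - 25 / 64 * Y ω) ∂μ := by
        refine integral_mono_ae hEi ((integrable_const _).sub (hYi.const_mul _)) ?_
        filter_upwards [hY1] with ω hω using exp_neg_half_mul_le (hY0 ω) hω
    _ = 1 - 25 / 64 * ∫ ω, Y ω ∂μ := by
        rw [integral_sub (integrable_const _) (hYi.const_mul _), integral_const_mul]; simp
    _ ≤ Real.exp (-(25 / 64 * smoothedRegularity lamA σ S)) := by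
        linarith [Real.add_one_le_exp (-(25 / 64 * smoothedRegularity lamA σ S))]

end WorstCandidate

/-! ### Independence of rounds and the lower tail -/

section Rounds

variable {Ω : Type*} [MeasurableSpace Ω] {μ : Measure Ω} [IsProbabilityMeasure μ]

/-- Functions of disjoint blocks of independent variables have a multiplicative expectation. -/
lemma lintegral_prod_blocks {E : Type*} [MeasurableSpace E] {N : ℕ} {K : Fin N → ℕ}
    (f : (p : Σ i : Fin N, Fin (K i)) → Ω → E) (hf : ∀ p, Measurable (f p))
    (hind : iIndepFun f μ) (G : (i : Fin N) → (Fin (K i) → E) → ENNReal)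
    (hG : ∀ i, Measurable (G i)) (s : Finset (Fin N)) :
    ∫⁻ ω, ∏ i ∈ s, G i (fun k => f ⟨i, k⟩ ω) ∂μ =
      ∏ i ∈ s, ∫⁻ ω, G i (fun k => f ⟨i, k⟩ ω) ∂μ := by
  classical
  induction s using Finset.induction_on with
  | empty => simp
  | insert a s ha ih =>
    simp_rw [Finset.prod_insert ha]
    rw [← ih]
    have hGm : ∀ i, Measurable fun ω => G i (fun k => f ⟨i, k⟩ ω) := fun i =>
      (hG i).comp (measurable_pi_lambda _ fun k => hf ⟨i, k⟩)
    refine lintegral_mul_eq_lintegral_mul_lintegral_of_indepFun (hGm a)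
      (Finset.measurable_prod _ fun i _ => hGm i) ?_
    set A : Finset (Σ i : Fin N, Fin (K i)) := ({a} : Finset (Fin N)).sigma fun _ => Finset.univ
    set B : Finset (Σ i : Fin N, Fin (K i)) := s.sigma fun _ => Finset.univ
    have hAB : Disjoint A B := by
      rw [Finset.disjoint_left]
      rintro ⟨i, k⟩ hA hB
      simp only [A, B, Finset.mem_sigma, Finset.mem_singleton, Finset.mem_univ, and_true] at hA hB
      exact ha (hA ▸ hB)
    have hAm : ∀ k, (⟨a, k⟩ : Σ i : Fin N, Fin (K i)) ∈ A := fun k => by simp [A]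
    have hBm : ∀ i ∈ s, ∀ k, (⟨i, k⟩ : Σ i : Fin N, Fin (K i)) ∈ B := fun i hi k => by simp [B, hi]
    have h := hind.indepFun_finset A B hAB hf
    have h2 := h.comp
      (φ := fun v : A → E => G a fun k => v ⟨⟨a, k⟩, hAm k⟩)
      -- `attach` supplies the membership proofs needed to index into the block `B`.
      (ψ := fun v : B → E => ∏ i ∈ s.attach, G i fun k => v ⟨⟨i, k⟩, hBm i i.2 k⟩)
      ((hG a).comp (measurable_pi_lambda _ fun k => measurable_pi_apply _))
      (Finset.measurable_prod _ fun i _ =>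
        (hG i).comp (measurable_pi_lambda _ fun k => measurable_pi_apply _))
    convert! h2 using 1
    ext ω
    exact (Finset.prod_attach s fun i => G i fun k => f ⟨i, k⟩ ω).symm

variable {U d : ℕ} {D : Dataset Ω U d} {ρ : Measure (Vec d)} {lamA σ : ℝ} {S : ℕ}

/-- Lower tail of the quadratic form `∑ᵢ ⟪x, aᵢ⟫²` in a fixed direction. -/
lemma measure_sum_inner_sq_le (hρ : RegularLaw ρ lamA σ) (hsel : SelectedFromCandidates μ D ρ S)
    (u : Fin U) {x : Vec d} (hx : ‖x‖ = 1) :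
    μ {ω | ∑ i, ⟪x, D.action u i ω⟫ ^ 2 ≤ 19 / 32 * (D.N u * smoothedRegularity lamA σ S)} ≤
      ENNReal.ofReal (Real.exp (-(3 / 32 * (D.N u * smoothedRegularity lamA σ S)))) := by
  set p := smoothedRegularity lamA σ S with hp
  obtain ⟨K, c, hKS, hcm, hind, hlaw, hact⟩ := hsel u
  -- The action of a round is almost surely one of its candidates, so there is at least one.
  have hK : ∀ i, NeZero (K i) := fun i => ⟨fun h0 => by
    obtain ⟨ω, k, -⟩ := (hact i).exists
    rw [h0] at k
    exact k.elim0⟩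
  set G : (i : Fin (D.N u)) → (Fin (K i) → Vec d) → ENNReal := fun i v =>
    ENNReal.ofReal (Real.exp (-((⨅ k, ⟪x, v k⟫ ^ 2) / 2))) with hGdef
  have hG : ∀ i, Measurable (G i) := fun i => by
    have : Measurable fun v : Fin (K i) → Vec d => ⨅ k, ⟪x, v k⟫ ^ 2 :=
      Measurable.iInf fun k => by fun_prop
    fun_prop
  have hprod := lintegral_prod_blocks (fun p : Σ i : Fin (D.N u), Fin (K i) => c p.1 p.2)
    (fun p => hcm p.1 p.2) hind G hG Finset.univ
  have hfac : ∀ i, ∫⁻ ω, G i (fun k => c i k ω) ∂μ ≤ ENNReal.ofReal (Real.exp (-(25 / 64 * p))) :=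
    fun i => lintegral_exp_neg_iInf_le hρ (hKS i) (c i) (hcm i)
      (hind.precomp (g := fun k => (⟨i, k⟩ : Σ i : Fin (D.N u), Fin (K i)))
        (fun k k' h => by simpa using h)) (hlaw i) hx
  -- The selected actions need not be independent across rounds; the minima over candidates are, and
  -- they bound the squares from below.
  have hE : ∫⁻ ω, ENNReal.ofReal (Real.exp (-((∑ i, ⟪x, D.action u i ω⟫ ^ 2) / 2))) ∂μ ≤
      ENNReal.ofReal (Real.exp (-(25 / 64 * (D.N u * p)))) := by
    calc _ ≤ ∫⁻ ω, ∏ i, G i (fun k => c i k ω) ∂μ := by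
          refine lintegral_mono_ae ?_
          filter_upwards [ae_all_iff.2 hact] with ω hω
          rw [hGdef]
          simp only
          rw [← ENNReal.ofReal_prod_of_nonneg fun _ _ => (Real.exp_pos _).le, ← Real.exp_sum,
            Finset.sum_neg_distrib, ← Finset.sum_div]
          gcongr with i
          obtain ⟨k, hk⟩ := hω i
          rw [hk]
          exact ciInf_le (f := fun k => ⟪x, c i k ω⟫ ^ 2) (Set.finite_range _).bddBelow k
      _ = ∏ i, ∫⁻ ω, G i (fun k => c i k ω) ∂μ := hprod
      _ ≤ ∏ _i : Fin (D.N u), ENNReal.ofReal (Real.exp (-(25 / 64 * p))) :=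
          Finset.prod_le_prod' fun i _ => hfac i
      _ = _ := by
          rw [← ENNReal.ofReal_prod_of_nonneg fun _ _ => (Real.exp_pos _).le, ← Real.exp_sum]
          congr 2
          simp; ring
  -- Markov threshold, half of `19/32` in the exponent; `25/64 - 19/64 = 3/32` remains.
  set e : ENNReal := ENNReal.ofReal (Real.exp (-(19 / 64 * (D.N u * p)))) with he
  have he0 : e ≠ 0 := by simpa [he] using Real.exp_pos _
  have hmeas : Measurable fun ω =>
      ENNReal.ofReal (Real.exp (-((∑ i, ⟪x, D.action u i ω⟫ ^ 2) / 2))) := by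
    have := D.measurable_action u
    fun_prop
  calc _ ≤ μ {ω | e ≤ ENNReal.ofReal (Real.exp (-((∑ i, ⟪x, D.action u i ω⟫ ^ 2) / 2)))} := by
        refine measure_mono fun ω hω => ?_
        rw [mem_ofPred_eq] at hω
        change e ≤ _
        rw [he]
        refine ENNReal.ofReal_le_ofReal (Real.exp_le_exp.2 ?_)
        linarith
    _ ≤ _ := meas_ge_le_lintegral_div hmeas.aemeasurable he0 ENNReal.ofReal_ne_top
    _ ≤ _ := by
        rw [ENNReal.div_le_iff he0 ENNReal.ofReal_ne_top]
        refine hE.trans_eq ?_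
        rw [he, ← ENNReal.ofReal_mul (Real.exp_pos _).le, ← Real.exp_add]
        congr 2
        ring

end Rounds

/-! ### Nets of the sphere -/

section Net

/-- Volume comparison: disjoint balls of radius `ε / 2` fit into the ball of radius `1 + ε / 2`. -/
lemma card_le_of_separated_sphere {d : ℕ} {ε : ℝ} (hε : 0 < ε) (s : Finset (Vec d))
    (hs : ∀ c ∈ s, ‖c‖ = 1) (h : ∀ c ∈ s, ∀ c' ∈ s, c ≠ c' → ε ≤ ‖c - c'‖) :
    (s.card : ℝ) ≤ (1 + 2 / ε) ^ d := by
  have hδ : 0 < ε / 2 := half_pos hε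
  have hr : 0 < 1 + ε / 2 := by linarith
  have hdisj : (s : Set (Vec d)).Pairwise (Function.onFun Disjoint fun c => Metric.ball c (ε / 2)) := by
    intro c hc c' hc' hcc
    apply Metric.ball_disjoint_ball
    rw [dist_eq_norm, add_halves]
    exact h c hc c' hc' hcc
  have hsub : (⋃ c ∈ s, Metric.ball c (ε / 2)) ⊆ Metric.ball (0 : Vec d) (1 + ε / 2) := by
    refine iUnion₂_subset fun c hc => Metric.ball_subset_ball' ?_
    rw [dist_zero_right, hs c hc, add_comm]
  have hI : (s.card : ENNReal) * ENNReal.ofReal ((ε / 2) ^ d) * volume (Metric.ball (0 : Vec d) 1) ≤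
      ENNReal.ofReal ((1 + ε / 2) ^ d) * volume (Metric.ball (0 : Vec d) 1) := by
    calc _ = volume (⋃ c ∈ s, Metric.ball c (ε / 2)) := by
          rw [measure_biUnion_finset hdisj fun c _ => measurableSet_ball]
          simp [Measure.addHaar_ball_of_pos volume _ hδ, mul_assoc]
      _ ≤ volume (Metric.ball (0 : Vec d) (1 + ε / 2)) := measure_mono hsub
      _ = _ := by rw [Measure.addHaar_ball_of_pos volume _ hr]; simp
  have hJ := (ENNReal.mul_le_mul_iff_left (Metric.measure_ball_pos volume (0 : Vec d) zero_lt_one).ne'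
    measure_ball_lt_top.ne).1 hI
  have hKr : (s.card : ℝ) * (ε / 2) ^ d ≤ (1 + ε / 2) ^ d := by
    have := ENNReal.toReal_le_of_le_ofReal (pow_nonneg hr.le _) hJ
    simpa [ENNReal.toReal_ofReal (pow_nonneg hδ.le d)] using this
  have h2 : (1 + 2 / ε) ^ d = (1 + ε / 2) ^ d / (ε / 2) ^ d := by
    rw [← div_pow]; congr 1; field_simp; ring
  rw [h2, le_div_iff₀ (pow_pos hδ d)]
  exact hKr

/-- A separated set of maximal cardinality is a net, since an uncovered point could be added to it.
-/
lemma exists_sphere_net (d : ℕ) {ε : ℝ} (hε : 0 < ε) :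
    ∃ s : Finset (Vec d), (∀ c ∈ s, ‖c‖ = 1) ∧ (s.card : ℝ) ≤ (1 + 2 / ε) ^ d ∧
      ∀ x : Vec d, ‖x‖ = 1 → ∃ c ∈ s, ‖x - c‖ ≤ ε := by
  classical
  let P : ℕ → Prop := fun n => ∃ s : Finset (Vec d), (∀ c ∈ s, ‖c‖ = 1) ∧
    (∀ c ∈ s, ∀ c' ∈ s, c ≠ c' → ε ≤ ‖c - c'‖) ∧ s.card = n
  have hbound : ∀ n, P n → n ≤ ⌊(1 + 2 / ε) ^ d⌋₊ := by
    rintro n ⟨s, h1, h2, rfl⟩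
    exact Nat.le_floor (card_le_of_separated_sphere hε s h1 h2)
  have h0 : P 0 := ⟨∅, by simp, by simp, rfl⟩
  obtain ⟨s, hs1, hs2, hs3⟩ := Nat.findGreatest_spec (Nat.zero_le ⌊(1 + 2 / ε) ^ d⌋₊) h0
  refine ⟨s, hs1, card_le_of_separated_sphere hε s hs1 hs2, fun x hx => ?_⟩
  by_contra! hcon
  have hxs : x ∉ s := fun h => by
    have := hcon x h
    rw [sub_self, norm_zero] at this
    linarith
  have hP : P (s.card + 1) := by
    refine ⟨insert x s, ?_, ?_, Finset.card_insert_of_notMem hxs⟩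
    · intro c hc
      rcases Finset.mem_insert.1 hc with rfl | hc
      · exact hx
      · exact hs1 c hc
    · intro c hc c' hc' hcc
      rcases Finset.mem_insert.1 hc with rfl | hcs <;>
        rcases Finset.mem_insert.1 hc' with rfl | hcs'
      · exact absurd rfl hcc
      · exact (hcon c' hcs').le
      · rw [norm_sub_rev]; exact (hcon c hcs).le
      · exact hs2 c hcs c' hcs' hcc
  have := Nat.le_findGreatest (hbound _ hP) hP
  omega

/-- A finite set of directions that controls all quadratic forms `⟪·, a⟫²` on the sphere. -/
lemma exists_quadratic_net {d : ℕ} (hd : 0 < d) {p : ℝ} (hp0 : 0 < p) (hp1 : p ≤ 1) :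
    ∃ s : Finset (Vec d), (∀ c ∈ s, ‖c‖ = 1) ∧
      ((d = 1 ∧ s.card ≤ 1) ∨ (2 ≤ d ∧ (s.card : ℝ) ≤ (44 / p) ^ d)) ∧
      ∀ x : Vec d, ‖x‖ = 1 → ∃ c ∈ s, ∀ a : Vec d, ‖a‖ ≤ 1 →
        ⟪c, a⟫ ^ 2 - 3 / 32 * p ≤ ⟪x, a⟫ ^ 2 := by
  rcases Nat.lt_or_ge d 2 with h1 | h2
  · obtain rfl : d = 1 := by omega
    -- On a line the two unit vectors give the same quadratic form, so one direction suffices. The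
    -- separate case is needed because `p` need not be below `1/2` here.
    refine ⟨{EuclideanSpace.single 0 (1 : ℝ)}, by simp, Or.inl ⟨rfl, by simp⟩, fun x hx => ?_⟩
    refine ⟨_, Finset.mem_singleton_self _, fun a _ => ?_⟩
    have hx0 : x 0 ^ 2 = 1 := by
      have := real_inner_self_eq_norm_sq x
      rw [PiLp.inner_apply, hx] at this
      simpa [sq] using this
    have h3 : ⟪x, a⟫ ^ 2 = a 0 ^ 2 := by
      rw [PiLp.inner_apply]
      simp only [Finset.univ_unique, Fin.default_eq_zero, Finset.sum_singleton]
      simp [mul_pow, hx0]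
    rw [h3, EuclideanSpace.inner_single_left]
    simp
    linarith
  -- The squares differ by `⟪x - c, a⟫ ⟪x + c, a⟫`, at most `2 ε = 3/32 p`; and `1 + 2 / ε ≤ 44 / p`
  -- since `1 + 128/3 ≤ 44`.
  · obtain ⟨s, hs1, hs2, hs3⟩ := exists_sphere_net d (ε := 3 / 64 * p) (by positivity)
    refine ⟨s, hs1, Or.inr ⟨h2, hs2.trans ?_⟩, fun x hx => ?_⟩
    · gcongr
      rw [le_div_iff₀ hp0, add_mul]
      have : 2 / (3 / 64 * p) * p = 128 / 3 := by field_simp; norm_num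
      rw [this]; linarith
    · obtain ⟨c, hc, hxc⟩ := hs3 x hx
      refine ⟨c, hc, fun a ha => ?_⟩
      have h4 : |⟪x - c, a⟫| ≤ 3 / 64 * p :=
        (abs_real_inner_le_norm _ _).trans
          ((mul_le_mul hxc ha (norm_nonneg _) (by positivity)).trans_eq (mul_one _))
      have h5 : |⟪x + c, a⟫| ≤ 2 := by
        refine (abs_real_inner_le_norm _ _).trans ?_
        have : ‖x + c‖ ≤ 2 := (norm_add_le _ _).trans (by rw [hx, hs1 c hc]; norm_num)
        nlinarith [norm_nonneg a, norm_nonneg (x + c)]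
      have h6 : ⟪x, a⟫ ^ 2 - ⟪c, a⟫ ^ 2 = ⟪x - c, a⟫ * ⟪x + c, a⟫ := by
        rw [inner_sub_left, inner_add_left]; ring
      have h7 : |⟪x - c, a⟫ * ⟪x + c, a⟫| ≤ 3 / 64 * p * 2 := by
        rw [abs_mul]; gcongr
      have := (abs_le.1 h7).1
      linarith

end Net

/-! ### The smallest eigenvalue of the Gram matrix and the confidence radius -/

section Numerics

lemma exp_neg_three_halves_log {r : ℝ} (hr : 0 < r) :
    Real.exp (-(3 / 2 * Real.log r)) = r⁻¹ * Real.sqrt r⁻¹ := by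
  rw [show -(3 / 2 * Real.log r) = Real.log r⁻¹ + Real.log r⁻¹ / 2 by rw [Real.log_inv]; ring,
    Real.exp_add, Real.exp_half, Real.exp_log (inv_pos.2 hr)]

lemma one_lt_Nmin_arg {U d : ℕ} (hU : 0 < U) (hd : 0 < d) {p δ : ℝ} (hp : 0 < p) (hpd : p * d ≤ 1)
    (hδ0 : 0 < δ) (hδ1 : δ < 1) : 1 < 8 * U * d / (p ^ 2 * δ) := by
  have hU' : (1 : ℝ) ≤ U := by exact_mod_cast hU
  have hd' : (1 : ℝ) ≤ d := by exact_mod_cast hd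
  have hp1 : p ≤ 1 := by nlinarith
  rw [one_lt_div (by positivity)]
  have h1 : p ^ 2 * δ < 1 := by
    have : p ^ 2 ≤ 1 := pow_le_one₀ hp.le hp1
    nlinarith
  nlinarith [mul_le_mul hU' hd' (by norm_num) (by linarith)]

lemma Nmin_pos {U d : ℕ} (hU : 0 < U) (hd : 0 < d) {p δ : ℝ} (hp : 0 < p) (hpd : p * d ≤ 1)
    (hδ0 : 0 < δ) (hδ1 : δ < 1) : 0 < Nmin U d p δ :=
  mul_pos (by positivity) (Real.log_pos (one_lt_Nmin_arg hU hd hp hpd hδ0 hδ1))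

/-- Since `p d ≤ 1`, the sample size gives `N p ≥ 16 d log r`, and `16 * 3/32 = 3/2`, so the
exponential is at most `(r^(-3/2))^d`. For `d ≥ 2` one has `p ≤ 1/2`, hence `r^(-1/2) ≤ 1/8`, while
the factor `p²` in `r⁻¹` absorbs the `1 / p` of the net. -/
lemma card_mul_exp_le {U d : ℕ} (hU : 0 < U) (hd : 0 < d) {p δ N n : ℝ} (hp : 0 < p)
    (hpd : p * d ≤ 1) (hδ0 : 0 < δ) (hδ1 : δ < 1) (hN : Nmin U d p δ ≤ N)
    (hn : (d = 1 ∧ n ≤ 1) ∨ (2 ≤ d ∧ n ≤ (44 / p) ^ d)) :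
    n * Real.exp (-(3 / 32 * (N * p))) ≤ δ / (2 * U) := by
  have hU' : (1 : ℝ) ≤ U := by exact_mod_cast hU
  have hd' : (1 : ℝ) ≤ d := by exact_mod_cast hd
  have hp1 : p ≤ 1 := by nlinarith
  have harg := one_lt_Nmin_arg hU hd hp hpd hδ0 hδ1
  set r := 8 * U * d / (p ^ 2 * δ) with hr
  have hL : 0 < Real.log r := Real.log_pos harg
  have hr0 : 0 < r := by linarith
  have hexp : Real.exp (-(3 / 32 * (N * p))) ≤ (r⁻¹ * Real.sqrt r⁻¹) ^ d := by
    rw [← exp_neg_three_halves_log hr0, ← Real.exp_nat_mul]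
    refine Real.exp_le_exp.2 ?_
    have h1 : 16 / p ^ 2 * Real.log r * p ≤ N * p := by gcongr; exact hN
    have h2 : 16 * (d * Real.log r) ≤ 16 / p ^ 2 * Real.log r * p := by
      have : 16 / p ^ 2 * Real.log r * p = 16 * Real.log r / p := by field_simp
      rw [this, le_div_iff₀ hp]
      nlinarith
    linarith
  have hrinv : r⁻¹ = p ^ 2 * δ / (8 * U * d) := by rw [hr, inv_div]
  have hsq0 := Real.sqrt_nonneg r⁻¹
  have hUd : δ / (2 * U) ≤ 1 := by
    rw [div_le_one (by positivity)]; linarith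
  rcases hn with ⟨rfl, hn⟩ | ⟨hd2, hn⟩
  · have h1 : Real.sqrt r⁻¹ ≤ 1 := by
      refine (Real.sqrt_le_left zero_le_one).2 ?_
      rw [one_pow]; exact inv_le_one_of_one_le₀ harg.le
    calc n * Real.exp (-(3 / 32 * (N * p))) ≤ 1 * (r⁻¹ * Real.sqrt r⁻¹) ^ 1 := by gcongr
      _ ≤ r⁻¹ := by rw [one_mul, pow_one]; exact mul_le_of_le_one_right (by positivity) h1
      _ ≤ δ / (2 * U) := by
        rw [hrinv, div_le_div_iff₀ (by positivity) (by positivity)]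
        have : p ^ 2 ≤ 1 := pow_le_one₀ hp.le hp1
        have h3 : p ^ 2 * (δ * (2 * U)) ≤ 1 * (δ * (2 * U)) := by gcongr
        have h4 : 0 < δ * U := by positivity
        push_cast
        linarith
  · have hd2' : (2 : ℝ) ≤ d := by exact_mod_cast hd2
    have hp2 : p ≤ 1 / 2 := by nlinarith
    have hpp : p ^ 2 ≤ 1 / 4 := by nlinarith
    have hq : r⁻¹ ≤ (1 / 8) ^ 2 := by
      rw [hrinv, div_le_iff₀ (by positivity)]
      have h1 : p ^ 2 * δ ≤ 1 / 4 * 1 := by gcongr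
      have h2 : (1 : ℝ) * 2 ≤ U * d := by gcongr
      nlinarith
    have hsq : Real.sqrt r⁻¹ ≤ 1 / 8 := (Real.sqrt_le_left (by norm_num)).2 hq
    have hbase : 44 / p * (r⁻¹ * Real.sqrt r⁻¹) ≤ δ / (2 * U) := by
      calc 44 / p * (r⁻¹ * Real.sqrt r⁻¹) ≤ 44 / p * (r⁻¹ * (1 / 8)) := by gcongr
        _ = 44 * p * δ / (64 * U * d) := by rw [hrinv]; field_simp; norm_num
        _ ≤ δ / (2 * U) := by
          rw [div_le_div_iff₀ (by positivity) (by positivity)]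
          have h1 : 44 * p * (δ * (2 * U)) ≤ 22 * (δ * (2 * U)) := by
            gcongr; linarith
          have h2 : δ * U * 2 ≤ δ * U * d := by gcongr
          nlinarith [mul_pos hδ0 (by linarith : (0 : ℝ) < U)]
    calc n * Real.exp (-(3 / 32 * (N * p)))
        ≤ (44 / p) ^ d * (r⁻¹ * Real.sqrt r⁻¹) ^ d := by gcongr
      _ = (44 / p * (r⁻¹ * Real.sqrt r⁻¹)) ^ d := (mul_pow _ _ _).symm
      _ ≤ (44 / p * (r⁻¹ * Real.sqrt r⁻¹)) ^ 1 :=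
          pow_le_pow_of_le_one (by positivity) (hbase.trans hUd) hd
      _ ≤ δ / (2 * U) := by rw [pow_one]; exact hbase

end Numerics

/-! ### Concentration of the Gram matrix and of the ridge estimate -/

section Concentration

variable {Ω : Type*} [MeasurableSpace Ω] {μ : Measure Ω} [IsProbabilityMeasure μ]
  {U d : ℕ} {D : Dataset Ω U d} {ρ : Measure (Vec d)} {lamA σ : ℝ} {S : ℕ} {θ : Fin U → Vec d}

/-- Union bound over the net. A net direction has quadratic form above `19/32 N p`, and passing to
an arbitrary unit vector costs `3/32 N p`, which leaves `N p / 2`. -/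
lemma measure_not_quadratic_ge_le (hρ : RegularLaw ρ lamA σ) (hsel : SelectedFromCandidates μ D ρ S)
    {p δ : ℝ} (hp : p = smoothedRegularity lamA σ S) (hδ0 : 0 < δ) (hδ1 : δ < 1) (u : Fin U)
    (hN : Nmin U d p δ ≤ D.N u) :
    μ {ω | ¬ ∀ x : Vec d, p * D.N u / 2 * ‖x‖ ^ 2 ≤ ∑ i, ⟪D.action u i ω, x⟫ ^ 2} ≤
      ENNReal.ofReal (δ / (2 * U)) := by
  have hU : 0 < U := u.pos
  have hd := hρ.dim_pos
  have hd' : (1 : ℝ) ≤ d := by exact_mod_cast hd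
  have hp0 : 0 < p := hp ▸ smoothedRegularity_pos hρ.lamA_pos hρ.sigma_pos S
  have hpd : p * d ≤ 1 := by
    refine le_trans ?_ hρ.lamA_mul_dim_le_one
    gcongr
    exact hp ▸ smoothedRegularity_le hρ.lamA_pos S
  have hp1 : p ≤ 1 := by nlinarith
  obtain ⟨s, hs1, hs2, hs3⟩ := exists_quadratic_net hd hp0 hp1
  have hsub : ∀ᵐ ω ∂μ,
      ω ∈ {ω | ¬ ∀ x : Vec d, p * D.N u / 2 * ‖x‖ ^ 2 ≤ ∑ i, ⟪D.action u i ω, x⟫ ^ 2} →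
      ω ∈ ⋃ c ∈ s, {ω | ∑ i, ⟪c, D.action u i ω⟫ ^ 2 ≤ 19 / 32 * (D.N u * p)} := by
    filter_upwards [hsel.ae_norm_action_le_one hρ u] with ω hω hbad
    by_contra hcon
    simp only [mem_iUnion, not_exists, mem_ofPred_eq, not_le] at hcon
    refine hbad fun x => ?_
    rcases eq_or_ne x 0 with rfl | hx
    · simp
    have hxn : ‖x‖ ≠ 0 := norm_ne_zero_iff.2 hx
    set y : Vec d := ‖x‖⁻¹ • x with hy
    have hyn : ‖y‖ = 1 := by rw [hy, norm_smul, norm_inv, norm_norm, inv_mul_cancel₀ hxn]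
    obtain ⟨c, hc, hcy⟩ := hs3 y hyn
    have h1 : p * D.N u / 2 ≤ ∑ i, ⟪y, D.action u i ω⟫ ^ 2 := by
      have h2 := Finset.sum_le_sum fun i (_ : i ∈ Finset.univ) => hcy (D.action u i ω) (hω i)
      rw [Finset.sum_sub_distrib] at h2
      have h3 := hcon c hc
      simp only [Finset.sum_const, Finset.card_univ, Fintype.card_fin, nsmul_eq_mul] at h2
      linarith
    have h4 : ∀ i, ⟪D.action u i ω, x⟫ ^ 2 = ‖x‖ ^ 2 * ⟪y, D.action u i ω⟫ ^ 2 := fun i => by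
      rw [hy, real_inner_smul_left, real_inner_comm, mul_pow, ← mul_assoc, ← mul_pow,
        mul_inv_cancel₀ hxn, one_pow, one_mul]
    simp_rw [h4]
    rw [← Finset.mul_sum, mul_comm]
    gcongr
  calc _ ≤ μ (⋃ c ∈ s, {ω | ∑ i, ⟪c, D.action u i ω⟫ ^ 2 ≤ 19 / 32 * (D.N u * p)}) :=
        measure_mono_ae hsub
    _ ≤ ∑ c ∈ s, μ {ω | ∑ i, ⟪c, D.action u i ω⟫ ^ 2 ≤ 19 / 32 * (D.N u * p)} :=
        measure_biUnion_finset_le _ _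
    _ ≤ ∑ _c ∈ s, ENNReal.ofReal (Real.exp (-(3 / 32 * (D.N u * p)))) := by
        refine Finset.sum_le_sum fun c hc => ?_
        have := measure_sum_inner_sq_le hρ hsel u (hs1 c hc)
        rwa [← hp] at this
    _ = ENNReal.ofReal (s.card * Real.exp (-(3 / 32 * (D.N u * p)))) := by
        rw [Finset.sum_const, nsmul_eq_mul, ENNReal.ofReal_mul (Nat.cast_nonneg _),
          ENNReal.ofReal_natCast]
    _ ≤ _ := ENNReal.ofReal_le_ofReal (card_mul_exp_le hU hd hp0 hpd hδ0 hδ1 hN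
        (hs2.imp (fun h => ⟨h.1, by exact_mod_cast h.2⟩) id))

/-- Splitting each reward into mean and noise makes the moment vector the noise plus `(M - lam) θ`;
the term `-lam • θ` is the ridge bias. -/
lemma Dataset.toEuclideanLin_ridge {lam : ℝ} (hlam : 0 < lam) (u : Fin U) (ω : Ω) :
    Matrix.toEuclideanLin (ridgeGram lam fun i => D.action u i ω) (D.ridge lam u ω) =
      D.noise θ u ω + Matrix.toEuclideanLin (ridgeGram lam fun i => D.action u i ω) (θ u) -
        lam • θ u := by
  have h := toEuclideanLin_ridgeGram_inv_mulVec (fun i => D.action u i ω) hlam (D.moment u ω)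
  have h2 : D.ridge lam u ω = WithLp.toLp 2
    (Matrix.mulVec (ridgeGram lam fun i => D.action u i ω)⁻¹ (D.moment u ω).ofLp) := rfl
  rw [h2, h, toEuclideanLin_ridgeGram, Dataset.noise, Dataset.moment, add_sub_assoc,
    add_sub_cancel_left, ← Finset.sum_add_distrib]
  refine Finset.sum_congr rfl fun i _ => ?_
  rw [← add_smul, real_inner_comm, sub_add_cancel]

/-- With high probability the ridge estimate of `u` lies within the confidence radius. -/
lemma measure_CI_le_le (hρ : RegularLaw ρ lamA σ) (hsel : SelectedFromCandidates μ D ρ S)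
    (hrew : SubGaussianRewards μ D θ) (hθ : ∀ u, ‖θ u‖ ≤ 1) {p lam δ : ℝ}
    (hp : p = smoothedRegularity lamA σ S) (hlam : 0 < lam) (hδ0 : 0 < δ) (hδ1 : δ < 1) (u : Fin U)
    (hN : Nmin U d p δ ≤ D.N u) :
    μ {ω | D.CI p lam δ u ≤ ‖D.ridge lam u ω - θ u‖} ≤ ENNReal.ofReal (δ / U) := by
  have hU : 0 < U := u.pos
  have hU' : (1 : ℝ) ≤ U := by exact_mod_cast hU
  have hd := hρ.dim_pos
  have hd' : (1 : ℝ) ≤ d := by exact_mod_cast hd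
  have hp0 : 0 < p := hp ▸ smoothedRegularity_pos hρ.lamA_pos hρ.sigma_pos S
  have hpd : p * d ≤ 1 := by
    refine le_trans ?_ hρ.lamA_mul_dim_le_one
    gcongr
    exact hp ▸ smoothedRegularity_le hρ.lamA_pos S
  have hNpos : (0 : ℝ) < D.N u := (Nmin_pos hU hd hp0 hpd hδ0 hδ1).trans_le hN
  set w : Ω → Vec d := fun ω => WithLp.toLp 2
    (Matrix.mulVec (ridgeGram lam fun i => D.action u i ω)⁻¹ (D.noise θ u ω).ofLp) with hwdef
  have hw : ∀ ω, Matrix.toEuclideanLin (ridgeGram lam fun i => D.action u i ω) (w ω) =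
      D.noise θ u ω := fun ω => toEuclideanLin_ridgeGram_inv_mulVec _ hlam _
  have hA := measure_not_quadratic_ge_le hρ hsel hp hδ0 hδ1 u hN
  have hB := measure_selfNormalized_gt_le hrew hd hlam u (hsel.ae_norm_action_le_one hρ u)
    (ε := δ / (2 * U)) (by positivity) w hw
  rw [one_div_div] at hB
  set b : ℝ := d * Real.log (1 + D.N u / (lam * d)) + 2 * Real.log (2 * U / δ) with hb
  have hb0 : 0 ≤ b := by
    have h1 : 0 ≤ Real.log (1 + D.N u / (lam * d)) :=
      Real.log_nonneg (le_add_of_nonneg_right (by positivity))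
    have h2 : 0 ≤ Real.log (2 * U / δ) := by
      refine Real.log_nonneg ?_
      rw [one_le_div hδ0]; linarith
    positivity
  calc _ ≤ μ ({ω | ¬ ∀ x : Vec d, p * D.N u / 2 * ‖x‖ ^ 2 ≤ ∑ i, ⟪D.action u i ω, x⟫ ^ 2} ∪
        {ω | b < ⟪w ω, D.noise θ u ω⟫}) := by
        refine measure_mono fun ω hω => ?_
        by_contra hcon
        rw [mem_union, not_or] at hcon
        obtain ⟨h1, h2⟩ := hcon
        have h3 := not_not.1 h1
        have h4 : ⟪w ω, D.noise θ u ω⟫ ≤ Real.sqrt b ^ 2 := by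
          rw [Real.sq_sqrt hb0]; exact not_lt.1 h2
        have h5 := norm_sub_lt_of_ridgeGram (fun i => D.action u i ω) hlam (hθ u)
          (Dataset.toEuclideanLin_ridge hlam u ω) (hw ω) (Real.sqrt_nonneg b) h4
          (by positivity) h3
        exact absurd h5 (not_lt.2 hω)
    _ ≤ _ := measure_union_le _ _
    _ ≤ ENNReal.ofReal (δ / (2 * U)) + ENNReal.ofReal (δ / (2 * U)) := add_le_add hA hB
    _ = _ := by
        rw [← ENNReal.ofReal_add (by positivity) (by positivity)]
        congr 1; field_simp; norm_num

end Concentration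

/-! ### Measurability of the graph -/

section Measurability

variable {Ω : Type*} [MeasurableSpace Ω]

lemma measurable_det_of_entries {n : ℕ} {M : Ω → Matrix (Fin n) (Fin n) ℝ}
    (hM : ∀ i j, Measurable fun ω => M ω i j) : Measurable fun ω => (M ω).det := by
  simp_rw [Matrix.det_apply]
  refine Finset.measurable_sum _ fun τ _ => ?_
  exact (Finset.measurable_prod _ fun i _ => hM _ _).const_smul _

/-- By the cofactor formula; a singular matrix causes no trouble, as the reciprocal of its
determinant is then 0. -/
lemma measurable_inv_of_entries {n : ℕ} {M : Ω → Matrix (Fin n) (Fin n) ℝ}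
    (hM : ∀ i j, Measurable fun ω => M ω i j) (i j : Fin n) :
    Measurable fun ω => (M ω)⁻¹ i j := by
  have hadj : Measurable fun ω => (M ω).adjugate i j := by
    simp_rw [Matrix.adjugate_apply]
    refine measurable_det_of_entries fun k l => ?_
    simp_rw [Matrix.updateRow_apply]
    split_ifs
    · exact measurable_const
    · exact hM k l
  simp_rw [Matrix.inv_def, Matrix.smul_apply, Ring.inverse_eq_inv', smul_eq_mul]
  exact (measurable_det_of_entries hM).inv.mul hadj

variable {U d : ℕ} (D : Dataset Ω U d)

lemma Dataset.measurable_ridge (lam : ℝ) (u : Fin U) : Measurable (D.ridge lam u) := by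
  have h1 := D.measurable_action u
  have h2 := D.measurable_reward u
  have hmom : Measurable (D.moment u) := by unfold Dataset.moment; fun_prop
  have hgram : ∀ i j, Measurable fun ω => D.gram lam u ω i j := fun i j => by
    simp only [Dataset.gram, Matrix.add_apply, Matrix.sum_apply, Matrix.vecMulVec_apply]
    fun_prop
  refine (WithLp.measurable_toLp 2 _).comp (measurable_pi_lambda _ fun i => ?_)
  simp only [Matrix.mulVec, dotProduct]
  refine Finset.measurable_sum _ fun j _ => (measurable_inv_of_entries hgram i j).mul ?_
  fun_prop

/-- Used for the measurability of the factors, which are defined by cases on adjacency. -/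
lemma Dataset.measurableSet_adj (lamT α lam δ γhat : ℝ) (u v : Fin U) :
    MeasurableSet {ω | (D.graph lamT α lam δ γhat ω).Adj u v} := by
  have h1 := D.measurable_ridge lam u
  have h2 := D.measurable_ridge lam v
  have h3 : MeasurableSet {ω | ‖D.ridge lam u ω - D.ridge lam v ω‖ <
      γhat - α * (D.CI lamT lam δ u + D.CI lamT lam δ v)} :=
    measurableSet_lt (by fun_prop) measurable_const
  exact (MeasurableSet.const _).inter (h3.inter (MeasurableSet.const _))

end Measurability

/-! ### Bounds on the confidence radius -/

section Radius

variable {Ω : Type*} [MeasurableSpace Ω] {U d : ℕ} (D : Dataset Ω U d)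

lemma log_two_mul_div_pos (hU : 0 < U) {δ : ℝ} (hδ0 : 0 < δ) (hδ1 : δ < 1) :
    0 < Real.log (2 * U / δ) := by
  have hU' : (1 : ℝ) ≤ U := by exact_mod_cast hU
  refine Real.log_pos ?_
  rw [one_lt_div hδ0]; linarith

/-- Discards the `d log` term under the root; the remaining `√lam > 0` makes the inequality strict,
which the half-open range of `αr` requires. -/
lemma Dataset.lt_CI {p lam δ : ℝ} (hp : 0 < p) (hlam : 0 < lam) (u : Fin U) (hN : 0 < D.N u) :
    2 * Real.sqrt (Real.log (2 * U / δ)) / Real.sqrt p * (1 / Real.sqrt (D.N u)) <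
      D.CI p lam δ u := by
  have hN' : (0 : ℝ) < D.N u := by exact_mod_cast hN
  have hsp := Real.sqrt_pos.2 hp
  have hsN := Real.sqrt_pos.2 hN'
  have hl0 : 0 ≤ Real.log (1 + D.N u / (lam * d)) :=
    Real.log_nonneg (le_add_of_nonneg_right (by positivity))
  have hden : Real.sqrt (p * D.N u / 2) = Real.sqrt p * Real.sqrt (D.N u) / Real.sqrt 2 := by
    rw [Real.sqrt_div (by positivity), Real.sqrt_mul hp.le]
  have h2 : Real.sqrt 2 * Real.sqrt 2 = 2 := Real.mul_self_sqrt (by norm_num)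
  have hs2 : (0 : ℝ) < Real.sqrt 2 := Real.sqrt_pos.2 (by norm_num)
  have hnum : Real.sqrt 2 * Real.sqrt (Real.log (2 * U / δ)) <
      Real.sqrt (d * Real.log (1 + D.N u / (lam * d)) + 2 * Real.log (2 * U / δ)) +
        Real.sqrt lam := by
    rw [← Real.sqrt_mul (by norm_num)]
    refine lt_add_of_le_of_pos (Real.sqrt_le_sqrt ?_) (Real.sqrt_pos.2 hlam)
    exact le_add_of_nonneg_left (by positivity)
  rw [Dataset.CI, hden]
  calc _ = Real.sqrt 2 * Real.sqrt (Real.log (2 * U / δ)) /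
        (Real.sqrt p * Real.sqrt (D.N u) / Real.sqrt 2) := by
        field_simp; linear_combination (-Real.sqrt (Real.log (2 * U / δ))) * h2
    _ < _ := by gcongr

/-- The hypotheses bound both `√lam` and the root in the numerator by `√2 √(L max{2, d})` with `L =
log (2U / δ)`; the `√2` from the denominator raises the constant to 4. -/
lemma Dataset.CI_le {p lam δ : ℝ} (hp : 0 < p) (u : Fin U) (hN : 0 < D.N u)
    (hL : 0 ≤ Real.log (2 * U / δ))
    (hlam_le : lam ≤ d * Real.log (1 + D.N u / (lam * d)) + 2 * Real.log (2 * U / δ))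
    (hlog : Real.log (1 + D.N u / (lam * d)) ≤ Real.log (2 * U / δ)) :
    D.CI p lam δ u ≤ 4 * Real.sqrt (Real.log (2 * U / δ) * max 2 (d : ℝ)) / Real.sqrt p *
      (1 / Real.sqrt (D.N u)) := by
  have hN' : (0 : ℝ) < D.N u := by exact_mod_cast hN
  have hsp := Real.sqrt_pos.2 hp
  have hsN := Real.sqrt_pos.2 hN'
  have hden : Real.sqrt (p * D.N u / 2) = Real.sqrt p * Real.sqrt (D.N u) / Real.sqrt 2 := by
    rw [Real.sqrt_div (by positivity), Real.sqrt_mul hp.le]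
  have h2 : Real.sqrt 2 * Real.sqrt 2 = 2 := Real.mul_self_sqrt (by norm_num)
  have hs2 : (0 : ℝ) < Real.sqrt 2 := Real.sqrt_pos.2 (by norm_num)
  set b := d * Real.log (1 + D.N u / (lam * d)) + 2 * Real.log (2 * U / δ) with hb
  have hbm : b ≤ 2 * (Real.log (2 * U / δ) * max 2 (d : ℝ)) := by
    have h3 : (d : ℝ) * Real.log (1 + D.N u / (lam * d)) ≤
        max 2 (d : ℝ) * Real.log (2 * U / δ) :=
      (mul_le_mul_of_nonneg_left hlog (Nat.cast_nonneg d)).trans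
        (mul_le_mul_of_nonneg_right (le_max_right _ _) hL)
    have h4 : 2 * Real.log (2 * U / δ) ≤ max 2 (d : ℝ) * Real.log (2 * U / δ) :=
      mul_le_mul_of_nonneg_right (le_max_left _ _) hL
    linarith
  have hsb : Real.sqrt b ≤ Real.sqrt 2 * Real.sqrt (Real.log (2 * U / δ) * max 2 (d : ℝ)) := by
    rw [← Real.sqrt_mul (by norm_num)]
    exact Real.sqrt_le_sqrt hbm
  have hsl : Real.sqrt lam ≤ Real.sqrt b := Real.sqrt_le_sqrt hlam_le
  rw [Dataset.CI, hden]
  calc _ ≤ 2 * (Real.sqrt 2 * Real.sqrt (Real.log (2 * U / δ) * max 2 (d : ℝ))) /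
        (Real.sqrt p * Real.sqrt (D.N u) / Real.sqrt 2) := by
        gcongr
        linarith
    _ = _ := by
        field_simp
        linear_combination (2 * Real.sqrt (Real.log (2 * U / δ) * max 2 (d : ℝ))) * h2

end Radius

/-! ### Choice of the factors -/

section Factors

/-- The least factor covering `s` is `s / g`, and it is below `hi` exactly when `s < hi * g`; it is
raised to `lo` if necessary. -/
lemma exists_homogeneous_factor {lo hi g : ℝ} (s : ℝ) (hlohi : lo < hi)
    (hs : 0 ≤ s) (hg : 0 ≤ g) : ∃ r ∈ Ico lo hi, s < hi * g → s ≤ r * g := by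
  by_cases h : s < hi * g
  · have hg0 : 0 < g := by
      rcases hg.eq_or_lt with h0 | h0
      · rw [← h0, mul_zero] at h; linarith
      · exact h0
    refine ⟨max lo (s / g), ⟨le_max_left _ _, max_lt hlohi ((div_lt_iff₀ hg0).2 h)⟩, fun _ => ?_⟩
    exact (div_le_iff₀ hg0).1 (le_max_right _ _)
  · exact ⟨lo, ⟨le_rfl, hlohi⟩, fun h' => absurd h' h⟩

/-- For `α > 1` the upper end itself works; otherwise the range is unbounded and `s / (g - γ)` is
available. -/
lemma exists_heterogeneous_factor {α hw γ g : ℝ} (s : ℝ) (hhw : 1 < α → 0 < hw) :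
    ∃ w, (0 < w ∧ (1 < α → w ≤ hw)) ∧
      (0 < s → γ < g → (1 < α → s ≤ hw * (g - γ)) → s ≤ w * (g - γ)) := by
  by_cases hα : 1 < α
  · exact ⟨hw, ⟨hhw hα, fun _ => le_rfl⟩, fun _ _ h => h hα⟩
  · by_cases h : 0 < s ∧ γ < g
    · have h2 := sub_pos.2 h.2
      refine ⟨s / (g - γ), ⟨div_pos h.1 h2, fun h' => absurd h' hα⟩, fun _ _ _ => ?_⟩
      rw [div_mul_cancel₀ _ h2.ne']
    · exact ⟨1, ⟨one_pos, fun h' => absurd h' hα⟩, fun h1 h2 => absurd ⟨h1, h2⟩ h⟩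

/-- The range has no positive lower end, so a factor too small to cover `s` always exists. -/
lemma exists_separating_factor {α hw γ g : ℝ} (s : ℝ) (hhw : 1 < α → 0 < hw) :
    ∃ w, (0 < w ∧ (1 < α → w ≤ hw)) ∧ (0 < s → w * (g - γ) < s) := by
  obtain ⟨c, hc, hcw⟩ : ∃ c, 0 < c ∧ (1 < α → c ≤ hw) := by
    by_cases hα : 1 < α
    · exact ⟨hw, hhw hα, fun _ => le_rfl⟩
    · exact ⟨1, one_pos, fun h => absurd h hα⟩
  by_cases hs : 0 < s
  · rcases le_or_gt g γ with h | h
    · exact ⟨c, ⟨hc, hcw⟩, fun _ => by nlinarith⟩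
    · have h2 := sub_pos.2 h
      refine ⟨min c (s / (g - γ) / 2), ⟨lt_min hc (by positivity), fun hα =>
        (min_le_left _ _).trans (hcw hα)⟩, fun _ => ?_⟩
      calc min c (s / (g - γ) / 2) * (g - γ) ≤ s / (g - γ) / 2 * (g - γ) := by
            gcongr; exact min_le_right _ _
        _ = s / 2 := by field_simp
        _ < s := by linarith
  · exact ⟨c, ⟨hc, hcw⟩, fun h => absurd h hs⟩

end Factors

/-! ### The neighbourhoods on the good event -/

section Neighbourhoods

variable {Ω : Type*} [MeasurableSpace Ω] {U d : ℕ} {D : Dataset Ω U d} {θ : Fin U → Vec d}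
  {p α lam δ γhat γ : ℝ} {u v : Fin U} {ω : Ω}

/-- The size `1 / √N_u + 1 / √N_v` of the statistical error for the pair `u`, `v`. -/
def Dataset.pairRate (D : Dataset Ω U d) (u v : Fin U) : ℝ :=
  1 / Real.sqrt (D.N u) + 1 / Real.sqrt (D.N v)

/-- Deterministic: the distance of the estimates is nonnegative, so an edge needs `α (CI_u + CI_v) <
γhat`. -/
lemma Dataset.pairRate_lt_of_adj (hp : 0 < p) (hlam : 0 < lam) (hα : 1 ≤ α)
    (hL : 0 < Real.log (2 * U / δ)) (hNu : 0 < D.N u) (hNv : 0 < D.N v)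
    (h : (D.graph p α lam δ γhat ω).Adj u v) :
    D.pairRate u v < Real.sqrt p / (2 * α * Real.sqrt (Real.log (2 * U / δ))) * γhat := by
  have hu := D.lt_CI (δ := δ) hp hlam u hNu
  have hv := D.lt_CI (δ := δ) hp hlam v hNv
  have hsp := Real.sqrt_pos.2 hp
  have hsL := Real.sqrt_pos.2 hL
  have hadj := h.2.1
  have h0 := norm_nonneg (D.ridge lam u ω - D.ridge lam v ω)
  have h1 : α * (2 * Real.sqrt (Real.log (2 * U / δ)) / Real.sqrt p * D.pairRate u v) < γhat := by
    have h2 : 2 * Real.sqrt (Real.log (2 * U / δ)) / Real.sqrt p * D.pairRate u v <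
        D.CI p lam δ u + D.CI p lam δ v := by
      rw [Dataset.pairRate, mul_add]; linarith
    have h3 := mul_lt_mul_of_pos_left h2 (by linarith : 0 < α)
    linarith
  have hα0 : 0 < α := by linarith
  calc D.pairRate u v = Real.sqrt p / (2 * α * Real.sqrt (Real.log (2 * U / δ))) *
        (α * (2 * Real.sqrt (Real.log (2 * U / δ)) / Real.sqrt p * D.pairRate u v)) := by
        field_simp
    _ < _ := by gcongr

/-- With a common preference vector, the estimates are less than `CI_u + CI_v` apart, so a missing
edge forces `γhat < (α + 1) (CI_u + CI_v)`. -/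
lemma Dataset.lt_pairRate_of_not_adj (hp : 0 < p) (hα : 1 ≤ α)
    (hL : 0 < Real.log (2 * U / δ)) (huv : u ≠ v) (hθ : θ u = θ v)
    (hCIu : D.CI p lam δ u ≤ 4 * Real.sqrt (Real.log (2 * U / δ) * max 2 (d : ℝ)) / Real.sqrt p *
      (1 / Real.sqrt (D.N u)))
    (hCIv : D.CI p lam δ v ≤ 4 * Real.sqrt (Real.log (2 * U / δ) * max 2 (d : ℝ)) / Real.sqrt p *
      (1 / Real.sqrt (D.N v)))
    (hNu : Nmin U d p δ ≤ D.N u) (hNv : Nmin U d p δ ≤ D.N v)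
    (hgu : ‖D.ridge lam u ω - θ u‖ < D.CI p lam δ u)
    (hgv : ‖D.ridge lam v ω - θ v‖ < D.CI p lam δ v)
    (h : ¬ (D.graph p α lam δ γhat ω).Adj u v) :
    Real.sqrt p / (4 * (α + 1) * Real.sqrt (Real.log (2 * U / δ) * max 2 (d : ℝ))) * γhat <
      D.pairRate u v := by
  have hsp := Real.sqrt_pos.2 hp
  have hm : (0 : ℝ) < max 2 (d : ℝ) := lt_max_of_lt_left (by norm_num)
  have hsL := Real.sqrt_pos.2 (mul_pos hL hm)
  set B := Real.sqrt (Real.log (2 * U / δ) * max 2 (d : ℝ)) with hB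
  have hnot : γhat - α * (D.CI p lam δ u + D.CI p lam δ v) ≤
      ‖D.ridge lam u ω - D.ridge lam v ω‖ :=
    not_lt.1 fun hlt => h ⟨huv, hlt, le_min hNu hNv⟩
  have htri : ‖D.ridge lam u ω - D.ridge lam v ω‖ ≤
      ‖D.ridge lam u ω - θ u‖ + ‖D.ridge lam v ω - θ v‖ := by
    rw [show D.ridge lam u ω - D.ridge lam v ω =
      (D.ridge lam u ω - θ u) - (D.ridge lam v ω - θ v) by rw [hθ]; abel]
    exact norm_sub_le _ _
  have h1 : γhat < (α + 1) * (4 * B / Real.sqrt p * D.pairRate u v) := by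
    have h2 : γhat < (α + 1) * (D.CI p lam δ u + D.CI p lam δ v) := by linarith
    refine h2.trans_le ?_
    have : 0 < α + 1 := by linarith
    gcongr
    rw [Dataset.pairRate, mul_add]
    linarith
  have hα1 : 0 < α + 1 := by linarith
  calc Real.sqrt p / (4 * (α + 1) * B) * γhat <
        Real.sqrt p / (4 * (α + 1) * B) * ((α + 1) * (4 * B / Real.sqrt p * D.pairRate u v)) := by
        gcongr
    _ = D.pairRate u v := by field_simp

lemma Dataset.norm_sub_lt_of_adj
    (hgu : ‖D.ridge lam u ω - θ u‖ < D.CI p lam δ u)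
    (hgv : ‖D.ridge lam v ω - θ v‖ < D.CI p lam δ v)
    (h : (D.graph p α lam δ γhat ω).Adj u v) :
    ‖θ u - θ v‖ < γhat - (α - 1) * (D.CI p lam δ u + D.CI p lam δ v) := by
  have hadj := h.2.1
  have htri : ‖θ u - θ v‖ ≤ ‖D.ridge lam u ω - D.ridge lam v ω‖ +
      ‖D.ridge lam u ω - θ u‖ + ‖D.ridge lam v ω - θ v‖ := by
    rw [show θ u - θ v = (D.ridge lam u ω - D.ridge lam v ω) - (D.ridge lam u ω - θ u) +
      (D.ridge lam v ω - θ v) by abel]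
    exact (norm_add_le _ _).trans (by gcongr; exact norm_sub_le _ _)
  linarith

lemma Dataset.pairRate_le_of_adj (hp : 0 < p) (hlam : 0 < lam) (hα : 1 < α)
    (hL : 0 < Real.log (2 * U / δ)) (hNu : 0 < D.N u) (hNv : 0 < D.N v)
    (hγ : γ ≤ ‖θ u - θ v‖)
    (h : ‖θ u - θ v‖ < γhat - (α - 1) * (D.CI p lam δ u + D.CI p lam δ v)) :
    D.pairRate u v ≤
      Real.sqrt p / (2 * (α - 1) * Real.sqrt (Real.log (2 * U / δ))) * (γhat - γ) := by
  have hu := D.lt_CI (δ := δ) hp hlam u hNu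
  have hv := D.lt_CI (δ := δ) hp hlam v hNv
  have hsp := Real.sqrt_pos.2 hp
  have hsL := Real.sqrt_pos.2 hL
  have hα1 : 0 < α - 1 := by linarith
  have h1 : (α - 1) * (2 * Real.sqrt (Real.log (2 * U / δ)) / Real.sqrt p * D.pairRate u v) ≤
      γhat - γ := by
    have h2 : 2 * Real.sqrt (Real.log (2 * U / δ)) / Real.sqrt p * D.pairRate u v <
        D.CI p lam δ u + D.CI p lam δ v := by
      rw [Dataset.pairRate, mul_add]; linarith
    have h3 := mul_lt_mul_of_pos_left h2 hα1
    linarith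
  calc D.pairRate u v = Real.sqrt p / (2 * (α - 1) * Real.sqrt (Real.log (2 * U / δ))) *
        ((α - 1) * (2 * Real.sqrt (Real.log (2 * U / δ)) / Real.sqrt p * D.pairRate u v)) := by
        field_simp
    _ ≤ _ := by gcongr

lemma Dataset.R_W_of_lt_Nmin (h : (D.N u : ℝ) < Nmin U d p δ) :
    D.R θ p α lam δ γhat u ω = {u} ∧ D.W θ p α lam δ γhat u ω = ∅ := by
  have hnadj : ∀ v, ¬ (D.graph p α lam δ γhat ω).Adj u v := fun v hv =>
    absurd (hv.2.2.trans (min_le_left _ _)) (not_le.2 h)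
  constructor
  · ext v
    simp only [Dataset.R, Dataset.nbhd, mem_ofPred_eq, mem_union, mem_singleton_iff, hnadj,
      or_false]
    exact ⟨fun hv => hv.1, fun hv => ⟨hv, by rw [hv]⟩⟩
  · ext v
    simp only [Dataset.W, Dataset.nbhd, mem_ofPred_eq, mem_union, mem_singleton_iff, hnadj,
      or_false, mem_empty_iff_false, iff_false, not_and, not_not]
    exact fun hv => by rw [hv]

end Neighbourhoods

end OffClusBand

end

/-! ### Random factors and the union bound over users -/

theorem mainTheorem4 {Ω : Type*} [MeasurableSpace Ω] (μ : Measure Ω) [IsProbabilityMeasure μ]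
    {U d : ℕ} (D : OffClusBand.Dataset Ω U d)
    -- preference vectors in the unit ball, with heterogeneity gap `γ`
    (θ : Fin U → OffClusBand.Vec d) (hθ : ∀ u, ‖θ u‖ ≤ 1)
    (γ : ℝ) (hγ : 0 < γ) (hgap : ∀ u v, θ u ≠ θ v → γ ≤ ‖θ u - θ v‖)
    -- action regularity, with smoothed regularity parameter `lamT`
    (ρ : Measure (OffClusBand.Vec d)) (lamA σ : ℝ) (S : ℕ)
    (hρ : OffClusBand.RegularLaw ρ lamA σ)
    (hsel : OffClusBand.SelectedFromCandidates μ D ρ S)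
    (lamT : ℝ) (hlamT : lamT = OffClusBand.smoothedRegularity lamA σ S)
    -- 1-sub-Gaussian rewards
    (hrew : OffClusBand.SubGaussianRewards μ D θ)
    -- inputs of the algorithm
    (α lam δ γhat : ℝ) (hα : 1 ≤ α) (hlam : 0 < lam) (hδ0 : 0 < δ) (hδ1 : δ < 1)
    (hγhat : 0 ≤ γhat)
    (hlam_le : lam ≤ d * Real.log (1 + ((⨅ u, D.N u : ℕ) : ℝ) / (lam * d)) +
      2 * Real.log (2 * U / δ))
    (hδ_le : δ ≤ 2 * U / (1 + ((⨆ u, D.N u : ℕ) : ℝ) / (lam * d))) :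
    ∃ αr αw : Fin U → Fin U → Ω → ℝ,
      (∀ u v, Measurable (αr u v) ∧ Measurable (αw u v)) ∧
      (∀ u v ω, αr u v ω ∈ Set.Ico
        (Real.sqrt lamT / (4 * (α + 1) * Real.sqrt (Real.log (2 * U / δ) * max 2 (d : ℝ))))
        (Real.sqrt lamT / (2 * α * Real.sqrt (Real.log (2 * U / δ))))) ∧
      (∀ u v ω, 0 < αw u v ω ∧
        -- for `α = 1` the upper end of the range is `+∞`
        (1 < α → αw u v ω ≤
          Real.sqrt lamT / (2 * (α - 1) * Real.sqrt (Real.log (2 * U / δ))))) ∧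
      1 - δ ≤ μ.real {ω | ∀ u,
        (OffClusBand.Nmin U d lamT δ ≤ D.N u →
          D.R θ lamT α lam δ γhat u ω = {u} ∪ {v | θ u = θ v ∧
            1 / Real.sqrt (D.N u) + 1 / Real.sqrt (D.N v) ≤ αr u v ω * γhat ∧
            OffClusBand.Nmin U d lamT δ ≤ D.N v} ∧
          D.W θ lamT α lam δ γhat u ω = {v | (γ ≤ ‖θ u - θ v‖ ∧ ‖θ u - θ v‖ ≤ γhat) ∧
            1 / Real.sqrt (D.N u) + 1 / Real.sqrt (D.N v) ≤ αw u v ω * (γhat - γ) ∧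
            OffClusBand.Nmin U d lamT δ ≤ D.N v}) ∧
        (D.N u < OffClusBand.Nmin U d lamT δ →
          D.R θ lamT α lam δ γhat u ω = {u} ∧ D.W θ lamT α lam δ γhat u ω = ∅)} := by
  classical
  have hU : 0 < U := by
    rcases Nat.eq_zero_or_pos U with rfl | h
    -- Without users the upper bound on `δ` reads `δ ≤ 0`.
    · simp at hδ_le
      linarith
    · exact h
  have hU' : (0 : ℝ) < U := by exact_mod_cast hU
  have : Nonempty (Fin U) := ⟨⟨0, hU⟩⟩
  have hd := hρ.dim_pos
  have hd' : (0 : ℝ) < d := by exact_mod_cast hd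
  have hp : 0 < lamT := hlamT ▸ OffClusBand.smoothedRegularity_pos hρ.lamA_pos hρ.sigma_pos S
  have hpd : lamT * d ≤ 1 := by
    refine le_trans ?_ hρ.lamA_mul_dim_le_one
    gcongr
    exact hlamT ▸ OffClusBand.smoothedRegularity_le hρ.lamA_pos S
  have hNmin := OffClusBand.Nmin_pos hU hd hp hpd hδ0 hδ1
  have hL := OffClusBand.log_two_mul_div_pos hU hδ0 hδ1
  have hsp := Real.sqrt_pos.2 hp
  have hsL := Real.sqrt_pos.2 hL
  have hm : (0 : ℝ) < max 2 (d : ℝ) := lt_max_of_lt_left (by norm_num)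
  have hN0 : ∀ u, OffClusBand.Nmin U d lamT δ ≤ D.N u → 0 < D.N u := fun u h => by
    exact_mod_cast hNmin.trans_le h
  -- An empty sample of `v` contributes `1 / √0 = 0`, so positivity comes from `u` alone.
  have hrate : ∀ u v, OffClusBand.Nmin U d lamT δ ≤ D.N u → 0 < D.pairRate u v := fun u v h => by
    have : (0 : ℝ) < D.N u := hNmin.trans_le h
    unfold OffClusBand.Dataset.pairRate
    positivity
  have hCI : ∀ u, OffClusBand.Nmin U d lamT δ ≤ D.N u → D.CI lamT lam δ u ≤
      4 * Real.sqrt (Real.log (2 * U / δ) * max 2 (d : ℝ)) / Real.sqrt lamT *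
      (1 / Real.sqrt (D.N u)) := fun u h => by
    refine D.CI_le hp u (hN0 u h) hL.le (hlam_le.trans ?_) ?_
    · gcongr
      exact ciInf_le' D.N u
    · refine Real.log_le_log (by positivity) ?_
      have h1 : (D.N u : ℝ) ≤ ((⨆ u, D.N u : ℕ) : ℝ) := by
        exact_mod_cast le_ciSup (Set.finite_range D.N).bddAbove u
      rw [le_div_iff₀ (by positivity)] at hδ_le
      rw [le_div_iff₀ hδ0, mul_comm]
      refine le_trans ?_ hδ_le
      gcongr
  set lo := Real.sqrt lamT /
    (4 * (α + 1) * Real.sqrt (Real.log (2 * U / δ) * max 2 (d : ℝ))) with hlo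
  set hi := Real.sqrt lamT / (2 * α * Real.sqrt (Real.log (2 * U / δ))) with hhi
  set hw := Real.sqrt lamT / (2 * (α - 1) * Real.sqrt (Real.log (2 * U / δ))) with hhw
  have hlohi : lo < hi := by
    have h1 : Real.sqrt (Real.log (2 * U / δ)) ≤
        Real.sqrt (Real.log (2 * U / δ) * max 2 (d : ℝ)) :=
      Real.sqrt_le_sqrt (le_mul_of_one_le_right hL.le
        ((by norm_num : (1 : ℝ) ≤ 2).trans (le_max_left _ _)))
    refine div_lt_div_of_pos_left hsp (by positivity) ?_
    calc 2 * α * Real.sqrt (Real.log (2 * U / δ))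
        < 4 * (α + 1) * Real.sqrt (Real.log (2 * U / δ)) := by gcongr <;> linarith
      _ ≤ _ := by gcongr
  have hhw0 : 1 < α → 0 < hw := fun h => by
    have : 0 < α - 1 := sub_pos.2 h
    positivity
  have hrate0 : ∀ u v, 0 ≤ D.pairRate u v := fun u v => by
    unfold OffClusBand.Dataset.pairRate; positivity
  choose r hr1 hr2 using fun u v =>
    OffClusBand.exists_homogeneous_factor (D.pairRate u v) hlohi (hrate0 u v) hγhat
  choose w hw1 hw2 using fun u v =>
    OffClusBand.exists_heterogeneous_factor (γ := γ) (g := γhat) (D.pairRate u v) hhw0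
  choose z hz1 hz2 using fun u v =>
    OffClusBand.exists_separating_factor (γ := γ) (g := γhat) (D.pairRate u v) hhw0
  -- `r`, `w`, `z` are deterministic; the outcome enters only through adjacency. A present edge
  -- takes a factor covering the rate, a missing one a factor that fails to.
  refine ⟨fun u v ω => if (D.graph lamT α lam δ γhat ω).Adj u v then r u v else lo,
    fun u v ω => if (D.graph lamT α lam δ γhat ω).Adj u v then w u v else z u v,
    fun u v => ⟨Measurable.ite (D.measurableSet_adj ..) measurable_const measurable_const,
      Measurable.ite (D.measurableSet_adj ..) measurable_const measurable_const⟩,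
    fun u v ω => ?_, fun u v ω => ?_, ?_⟩
  · dsimp only
    split_ifs
    · exact hr1 u v
    · exact ⟨le_rfl, hlohi⟩
  · dsimp only
    split_ifs
    · exact hw1 u v
    · exact hz1 u v
  set E : Set Ω := _
  change 1 - δ ≤ μ.real E
  set bad : Fin U → Set Ω := fun u =>
    {ω | OffClusBand.Nmin U d lamT δ ≤ D.N u ∧ D.CI lamT lam δ u ≤ ‖D.ridge lam u ω - θ u‖} with hbad
  have hbad_le : ∀ u, μ.real (bad u) ≤ δ / U := fun u => by
    by_cases h : OffClusBand.Nmin U d lamT δ ≤ D.N u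
    · refine ENNReal.toReal_le_of_le_ofReal (by positivity) (le_trans (measure_mono ?_)
        (OffClusBand.measure_CI_le_le hρ hsel hrew hθ hlamT hlam hδ0 hδ1 u h))
      exact fun ω hω => hω.2
    · have : bad u = ∅ := Set.eq_empty_of_forall_notMem fun ω hω => h hω.1
      rw [this, measureReal_empty]
      positivity
  -- Covering the whole space and using subadditivity requires no measurability of `E`.
  have hcover : Set.univ ⊆ E ∪ ⋃ u, bad u := by
    intro ω _
    by_cases hω : ω ∈ ⋃ u, bad u
    · exact Or.inr hω
    refine Or.inl fun u => ⟨fun hNu => ?_, OffClusBand.Dataset.R_W_of_lt_Nmin⟩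
    have hgood : ∀ u, OffClusBand.Nmin U d lamT δ ≤ D.N u →
        ‖D.ridge lam u ω - θ u‖ < D.CI lamT lam δ u := fun u h => by
      by_contra hcon
      exact hω (Set.mem_iUnion.2 ⟨u, h, not_lt.1 hcon⟩)
    have hNv_of_adj : ∀ v, (D.graph lamT α lam δ γhat ω).Adj u v → OffClusBand.Nmin U d lamT δ ≤ D.N v :=
      fun v h => h.2.2.trans (min_le_right _ _)
    constructor
    · ext v
      constructor
      · rintro ⟨hv | hadj, hθv⟩
        · exact Or.inl hv
        · change (D.graph lamT α lam δ γhat ω).Adj u v at hadj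
          refine Or.inr ⟨hθv, ?_, hNv_of_adj v hadj⟩
          simp only [if_pos hadj]
          exact hr2 u v (OffClusBand.Dataset.pairRate_lt_of_adj hp hlam hα hL (hN0 u hNu)
            (hN0 v (hNv_of_adj v hadj)) hadj)
      · rintro (hv | ⟨hθv, hs, hNv⟩)
        · exact ⟨Or.inl hv, by rw [Set.mem_singleton_iff.1 hv]⟩
        · refine ⟨?_, hθv⟩
          by_cases huv : u = v
          · exact Or.inl huv.symm
          refine Or.inr ?_
          change (D.graph lamT α lam δ γhat ω).Adj u v
          by_contra hadj
          simp only [if_neg hadj] at hs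
          exact absurd hs (not_le.2 (OffClusBand.Dataset.lt_pairRate_of_not_adj hp hα hL huv hθv (hCI u hNu)
            (hCI v hNv) hNu hNv (hgood u hNu) (hgood v hNv) hadj))
    · ext v
      constructor
      · rintro ⟨hv | hadj, hθv⟩
        · exact absurd (by rw [Set.mem_singleton_iff.1 hv]) hθv
        · change (D.graph lamT α lam δ γhat ω).Adj u v at hadj
          have hNv := hNv_of_adj v hadj
          have hlt := OffClusBand.Dataset.norm_sub_lt_of_adj (hgood u hNu) (hgood v hNv) hadj
          have hg := hgap u v hθv
          have hCIu := (norm_nonneg _).trans_lt (hgood u hNu)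
          have hCIv := (norm_nonneg _).trans_lt (hgood v hNv)
          have hnn : 0 ≤ (α - 1) * (D.CI lamT lam δ u + D.CI lamT lam δ v) :=
            mul_nonneg (sub_nonneg.2 hα) (by linarith)
          refine ⟨⟨hg, by linarith⟩, ?_, hNv⟩
          simp only [if_pos hadj]
          exact hw2 u v (hrate u v hNu) (by linarith) fun hα1 =>
            OffClusBand.Dataset.pairRate_le_of_adj hp hlam hα1 hL (hN0 u hNu) (hN0 v hNv) hg hlt
      -- No concentration is needed here: without an edge the factor is `z`, which contradicts `hs`.
      · rintro ⟨⟨hg, -⟩, hs, hNv⟩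
        refine ⟨Or.inr ?_, fun hθv => ?_⟩
        · change (D.graph lamT α lam δ γhat ω).Adj u v
          by_contra hadj
          simp only [if_neg hadj] at hs
          exact absurd hs (not_le.2 (hz2 u v (hrate u v hNu)))
        · rw [hθv, sub_self, norm_zero] at hg
          linarith
  have h1 : (1 : ℝ) ≤ μ.real E + ∑ u, μ.real (bad u) := by
    calc (1 : ℝ) = μ.real Set.univ := by simp
      _ ≤ μ.real (E ∪ ⋃ u, bad u) := measureReal_mono hcover
      _ ≤ μ.real E + μ.real (⋃ u, bad u) := measureReal_union_le _ _
      _ ≤ _ := by gcongr; exact measureReal_iUnion_fintype_le _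
  have h2 : ∑ u, μ.real (bad u) ≤ δ := by
    calc ∑ u, μ.real (bad u) ≤ ∑ _u : Fin U, δ / U := Finset.sum_le_sum fun u _ => hbad_le u
      _ = δ := by simp; field_simp
  linarith
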